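/- For a group $X$, the variety generated by $X$ is the set of its identities, i.e. of the words $w$ in the free group on countably many letters such that $w(x_1,x_2,\dots)=1$ for all $x_1,x_2,\dots\in X$. For a set $V$ of words and a group $X$ let $V(X)$ be the subgroup of $X$ generated by all values in $X$ of words in $V$; the relatively free group of rank $N$ in $V$ is $F_N/V(F_N)$, where $F_N$ is the free group of rank $N$. For finitely generated groups $G,H$, one says that $G$ preforms $H$ if there are a finite generating set $T$ of $H$ and a sequence $S_1,S_2,\dots$ of finite generating sets of $G$, with bijections $S_n\to T$, such that for every $R\in\mathbb N$ and all large enough $n$ the balls of radius $R$ around $1$ in the marked Cayley graphs of $(G,S_n)$ and $(H,T)$ are isomorphic. Theorem. Let $G$ be a $k$-generated nilpotent group, and assume that $G$ and $G/\mathrm{Torsion}(G)$ generate the same variety $V$. Then for every $N>k$ the group $G$ preforms the relatively free group $F_N/V(F_N)$. Moreover, for every $N>k$, the group $F_N/V(F_N)$, marked by the images of the $N$ free generators of $F_N$, lies in the closure of the set of marked groups $(G,S)$, where $S$ runs over all ordered generating families of $G$ of length $N$, in the space of groups marked by $N$ generators (the space of normal subgroups of $F_N$, with the Chabauty–Grigorchuk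 topology). Consequently, if $G$ is non-trivial, the connected component of $G$ has diameter $2$, in the unoriented graph whose vertices are the isomorphism classes of finitely generated groups and in which two distinct classes are joined by an edge if one of them preforms the other. -/

import Mathlib

open Filter

universe u v

/-- A subgroup generated by a conjugation-invariant set is normal. -/
theorem normal_closure_of_conj_mem {G : Type u} [Group G] {s : Set G}
    (hs : ∀ x ∈ s, ∀ g : G, g * x * g⁻¹ ∈ s) : (Subgroup.closure s).Normal := by
  refine ⟨fun x hx g => ?_⟩
  have hle : Subgroup.closure s ≤ (Subgroup.closure s).comap (MulAut.conj g).toMonoidHom := by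
    rw [Subgroup.closure_le]
    intro y hy
    exact Subgroup.subset_closure (hs y hy g)
  exact hle hx

/-! ### Torsion -/

/-- The torsion subgroup: the subgroup generated by the elements of finite order. In a nilpotent
group the elements of finite order already form a subgroup. -/
def torsionSubgroup (G : Type u) [Group G] : Subgroup G :=
  Subgroup.closure {g : G | IsOfFinOrder g}

instance torsionSubgroup_normal (G : Type u) [Group G] : (torsionSubgroup G).Normal :=
  normal_closure_of_conj_mem fun x hx g => by
    obtain ⟨n, hn, h⟩ := isOfFinOrder_iff_pow_eq_one.mp hx
    exact isOfFinOrder_iff_pow_eq_one.mpr ⟨n, hn, by rw [conj_pow, h]; simp⟩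

/-! ### Varieties of groups -/

/-- The variety generated by `G`, as the set of its identities: the words `w` in countably many
letters such that `w(g₀, g₁, …) = 1` for all `g₀, g₁, … ∈ G`. -/
def groupVariety (G : Type u) [Group G] : Set (FreeGroup ℕ) :=
  {w | ∀ g : ℕ → G, FreeGroup.lift g w = 1}

/-- The verbal subgroup `V(H)`, generated by all values in `H` of the words in `V`. -/
def verbalSubgroup (V : Set (FreeGroup ℕ)) (H : Type u) [Group H] : Subgroup H :=
  Subgroup.closure {x : H | ∃ w ∈ V, ∃ h : ℕ → H, FreeGroup.lift h w = x}

instance verbalSubgroup_normal (V : Set (FreeGroup ℕ)) (H : Type u) [Group H] :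
    (verbalSubgroup V H).Normal :=
  normal_closure_of_conj_mem fun x hx g => by
    obtain ⟨w, hw, h, rfl⟩ := hx
    refine ⟨w, hw, fun i => g * h i * g⁻¹, ?_⟩
    have key : FreeGroup.lift (fun i => g * h i * g⁻¹) =
        (MulAut.conj g).toMonoidHom.comp (FreeGroup.lift h) := by
      refine FreeGroup.ext_hom _ _ fun a => ?_
      simp
    rw [key]
    rfl

/-- The relatively free group of rank `N` in the variety `V`. -/
abbrev RelativelyFreeGroup (V : Set (FreeGroup ℕ)) (N : ℕ) : Type :=
  FreeGroup (Fin N) ⧸ verbalSubgroup V (FreeGroup (Fin N))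

/-! ### Marked Cayley graphs and the limit preorder -/

/-- The ball of radius `R` around `1` in the Cayley graph of `G` with respect to the family `s`:
the elements that are values of words of length at most `R` in the `s i` and their inverses. -/
def cayleyBall {ι : Type v} {G : Type u} [Group G] (s : ι → G) (R : ℕ) : Set G :=
  {g | ∃ l : List (ι × Bool), l.length ≤ R ∧ FreeGroup.lift s (FreeGroup.mk l) = g}

/-- The balls of radius `R` in the Cayley graphs of `G` and `H`, marked by `s` and `t`
respectively, are isomorphic: there is a bijection between them that maps `1` to `1` and
preserves and reflects the edges (from `x` to `x * s i`, labelled `i`). -/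
def CayleyBallsIsomorphic {ι : Type*} {G : Type u} {H : Type v} [Group G] [Group H]
    (s : ι → G) (t : ι → H) (R : ℕ) : Prop :=
  ∃ φ : cayleyBall s R ≃ cayleyBall t R,
    (∀ x : cayleyBall s R, (x : G) = 1 ↔ (φ x : H) = 1) ∧
    ∀ (x y : cayleyBall s R) (i : ι), (y : G) = x * s i ↔ (φ y : H) = φ x * t i

/-- `G` preforms `H`: there are a finite generating set `T` of `H` and a sequence of finite
generating sets `Sₙ` of `G`, in bijection with `T`, such that for each `R` the balls of radius `R`
in the marked Cayley graphs of `(G, Sₙ)` and `(H, T)` are isomorphic for all large `n`. -/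
def Preforms (G : Type u) (H : Type v) [Group G] [Group H] : Prop :=
  ∃ T : Finset H, Subgroup.closure (T : Set H) = ⊤ ∧
    ∃ S : ℕ → T → G,
      (∀ n, Function.Injective (S n) ∧ Subgroup.closure (Set.range (S n)) = ⊤) ∧
      ∀ R : ℕ, ∀ᶠ n in atTop, CayleyBallsIsomorphic (S n) (fun t : T => (t : H)) R

/-! ### The space of marked groups -/

/-- The space of groups marked by an ordered family of `N` generators, considered up to
isomorphism of marked groups: the normal subgroups of the free group of rank `N`. -/
def MarkedGroupSpace (N : ℕ) : Type :=
  {K : Subgroup (FreeGroup (Fin N)) // K.Normal}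

open scoped Classical in
/-- The Chabauty-Grigorchuk topology: `K` and `K'` are close if they contain the same words of
length at most `R`, for large `R`. -/
noncomputable instance MarkedGroupSpace.instTopologicalSpace (N : ℕ) :
    TopologicalSpace (MarkedGroupSpace N) :=
  TopologicalSpace.induced
    (fun (K : MarkedGroupSpace N) (w : FreeGroup (Fin N)) => (decide (w ∈ K.1) : Bool))
    inferInstance

/-- The set of all marked copies of `G` with `N` generators. -/
def markedCopies (G : Type u) [Group G] (N : ℕ) : Set (MarkedGroupSpace N) :=
  {K | ∃ f : FreeGroup (Fin N) →* G, Function.Surjective f ∧ f.ker = K.1}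

/-- The relatively free group of rank `N`, marked by its free generators. -/
def markedRelativelyFreeGroup (V : Set (FreeGroup ℕ)) (N : ℕ) : MarkedGroupSpace N :=
  ⟨verbalSubgroup V (FreeGroup (Fin N)), verbalSubgroup_normal V _⟩

/-! ### The graph of finitely generated groups -/

/-- Isomorphism of finitely generated groups. -/
def fgGroupSetoid : Setoid {A : GrpCat.{u} // Group.FG A} where
  r A B := Nonempty (A.1 ≃* B.1)
  iseqv :=
    { refl := fun _ => ⟨MulEquiv.refl _⟩
      symm := fun ⟨e⟩ => ⟨e.symm⟩
      trans := fun ⟨e⟩ ⟨f⟩ => ⟨e.trans f⟩ }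

/-- The isomorphism classes of finitely generated groups. -/
def FGGroupClass : Type (u + 1) := Quotient fgGroupSetoid.{u}

/-- The isomorphism class of a finitely generated group. -/
def FGGroupClass.mk (G : Type u) [Group G] [hG : Group.FG G] : FGGroupClass.{u} :=
  Quotient.mk fgGroupSetoid ⟨GrpCat.of G, hG⟩

/-- The relation between isomorphism classes that is induced by `Preforms`. -/
def FGGroupClass.Preforms (a b : FGGroupClass.{u}) : Prop :=
  ∃ (A B : Type u) (_ : Group A) (_ : Group B) (_ : Group.FG A) (_ : Group.FG B),
    a = FGGroupClass.mk A ∧ b = FGGroupClass.mk B ∧ _root_.Preforms A B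

/-- The unoriented graph on the isomorphism classes of finitely generated groups in which two
distinct classes are adjacent if one of them preforms the other. -/
def preformGraph : SimpleGraph FGGroupClass.{u} :=
  SimpleGraph.fromRel FGGroupClass.Preforms

/-- The connected component of a finitely generated group in that graph. -/
def preformComponent (G : Type u) [Group G] [Group.FG G] :
    preformGraph.{u}.ConnectedComponent :=
  preformGraph.connectedComponentMk (FGGroupClass.mk G)

/-! Let `G` be generated by `n` elements, and suppose that every generating `(n + 1)`-tuple of `G`
satisfies some word of a finite set `W` of non-identities. The quotient `X` of `G` by its torsion is
torsion-free nilpotent, and a word evaluated along curves `b ↦ g * h ^ b` is a polynomial sequence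
in `X`. Such a sequence is trivial as soon as it is trivial infinitely often
(`IsPolySeq.eq_one_of_infinite`), so the tuples over `X` behave like the points of an irreducible
variety. Since `X` has the same identities as `G`, no word of `W` is an identity of `X`, and some
tuple over `X` satisfies no word of `W` (`exists_forall_lift_ne_one`).

On the other hand, a tuple generates a nilpotent group as soon as it generates the abelianization.
Hence, if `t` is the image in `X` of a generating `n`-tuple of `G`, then for every `u` the tuple
`(u, t)` satisfies a word of `W`, and keeps doing so after Nielsen moves and changes by commutators
(`AlwaysSatisfies`). This property also passes along polynomial curves. The spare entry `u`,
available because the rank exceeds the number of generators, serves to move `t` to an arbitrary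
tuple (`AlwaysSatisfies.update`, `AlwaysSatisfies.of_generating`), a contradiction. So generating
tuples of `G` can avoid any finite set of non-identities, which is the asserted convergence.

In the graph, edges preserve being nilpotent with variety `V`: identities pass to limits, and a
nilpotent limit is finitely presented, hence maps onto the groups that approximate it. As `V` is the
variety of a torsion-free group, it contains the roots of its elements; therefore all groups in the
component satisfy the hypothesis on varieties, and any two of them preform a common relatively free
group. The products of `X` with cyclic groups of order 2 and 3 lie in the component and are not
adjacent, because an element of prime order in a limit already occurs in the approximating groups.
-/

open scoped commutatorElement

/-! ### Polynomial sequences in nilpotent groups -/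

/-- The lower central series is an N-series. -/
theorem commutator_lowerCentralSeries_le {X : Type*} [Group X] (i j : ℕ) :
    ⁅(⊤ : Subgroup X).lowerCentralSeries i, (⊤ : Subgroup X).lowerCentralSeries j⁆ ≤
      (⊤ : Subgroup X).lowerCentralSeries (i + j + 1) := by
  induction j generalizing i with
  | zero => exact le_of_eq rfl
  | succ j ih =>
    set γ := (⊤ : Subgroup X).lowerCentralSeries with hγ
    -- Modulo the target term, the three subgroups lemma applies to `γ i`, `γ j` and the whole
    -- group.
    let q := QuotientGroup.mk' (γ (i + (j + 1) + 1))
    have key : ∀ {A : Subgroup X}, A ≤ γ (i + (j + 1) + 1) → A.map q = ⊥ := fun h => by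
      rw [Subgroup.map_eq_bot_iff, QuotientGroup.ker_mk']
      exact h
    have hsucc : γ (j + 1) = ⁅γ j, (⊤ : Subgroup X)⁆ := rfl
    have h1 : ⁅⁅(⊤ : Subgroup X).map q, (γ i).map q⁆, (γ j).map q⁆ = ⊥ := by
      rw [← Subgroup.map_commutator, ← Subgroup.map_commutator]
      apply key
      rw [Subgroup.commutator_comm ⊤]
      refine (ih (i + 1)).trans (le_of_eq ?_)
      congr 1
      ring
    have h2 : ⁅⁅(γ i).map q, (γ j).map q⁆, (⊤ : Subgroup X).map q⁆ = ⊥ := by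
      rw [← Subgroup.map_commutator, ← Subgroup.map_commutator]
      apply key
      exact Subgroup.commutator_mono (ih i) le_rfl
    have h3 := Subgroup.commutator_commutator_eq_bot_of_rotate h1 h2
    rw [← Subgroup.map_commutator, ← Subgroup.map_commutator, Subgroup.map_eq_bot_iff,
      QuotientGroup.ker_mk', ← hsucc, Subgroup.commutator_comm] at h3
    exact h3

/-- Polynomial sequences in a group, graded by weight: the powers of an element have weight `0`,
constant sequences have weight `1`. -/
inductive IsPolySeq {X : Type u} [Group X] : ℕ → (ℕ → X) → Prop
  | pow (g : X) : IsPolySeq 0 (fun n => g ^ n)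
  | const (g : X) : IsPolySeq 1 (fun _ => g)
  | one (s : ℕ) : IsPolySeq s 1
  | mul {s : ℕ} {a b : ℕ → X} : IsPolySeq s a → IsPolySeq s b → IsPolySeq s (a * b)
  | inv {s : ℕ} {a : ℕ → X} : IsPolySeq s a → IsPolySeq s a⁻¹
  | comm {s t : ℕ} {a b : ℕ → X} : IsPolySeq s a → IsPolySeq t b → IsPolySeq (s + t + 1) ⁅a, b⁆
  | mono {s : ℕ} {a : ℕ → X} : IsPolySeq (s + 1) a → IsPolySeq s a

namespace IsPolySeq

variable {X : Type u} [Group X] {s t : ℕ} {a b f : ℕ → X}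

theorem of_le (h : IsPolySeq t a) (hst : s ≤ t) : IsPolySeq s a := by
  induction t, hst using Nat.le_induction with
  | base => exact h
  | succ n _ ih => exact ih h.mono

theorem conj (ha : IsPolySeq s a) (hb : IsPolySeq t b) : IsPolySeq s (b * a * b⁻¹) := by
  have h : b * a * b⁻¹ = ⁅b, a⁆ * a := by simp [commutatorElement_def]
  rw [h]
  exact ((hb.comm ha).of_le (by omega)).mul ha

/-- The multiplicative difference of a sequence. -/
def diff (f : ℕ → X) : ℕ → X := f⁻¹ * fun n => f (n + 1)

/-- The difference of a product is a product of a conjugate of one difference and the other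
difference. That of `⁅a, b⁆` is a product of conjugates of commutators that involve `diff a` or
`diff b`, so it gains one unit of weight; conjugation costs none. -/
theorem diff_mem (h : IsPolySeq s f) : IsPolySeq (s + 1) (diff f) := by
  have shift : ∀ f : ℕ → X, (fun n => f (n + 1)) = f * diff f := fun f => by simp [diff]
  induction h with
  | pow g =>
    have : diff (fun n => g ^ n) = fun _ => g := by
      funext n
      simp [diff, pow_succ]
    rw [this]
    exact const g
  | const g =>
    have : diff (fun _ => g) = (1 : ℕ → X) := by
      funext n
      simp [diff]
    rw [this]
    exact one _
  | one s =>
    have : diff (1 : ℕ → X) = 1 := by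
      funext n
      simp [diff]
    rw [this]
    exact one _
  | @mul s a b ha hb iha ihb =>
    have h : diff (a * b) = b⁻¹ * diff a * b⁻¹⁻¹ * diff b := by
      funext n
      simp [diff, mul_assoc]
    rw [h]
    exact (iha.conj hb.inv).mul ihb
  | @inv s a ha iha =>
    have h : diff a⁻¹ = a * (diff a)⁻¹ * a⁻¹ := by
      funext n
      simp [diff, mul_assoc]
    rw [h]
    exact iha.inv.conj ha
  | @comm s t a b ha hb iha ihb =>
    have hσ : (fun n => ⁅a, b⁆ (n + 1)) = ⁅a * diff a, b * diff b⁆ := by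
      rw [← shift, ← shift]
      rfl
    have h : diff ⁅a, b⁆ = ⁅a, b⁆⁻¹ * (a * ⁅diff a, b * diff b⁆ * a⁻¹) * ⁅a, b⁆⁻¹⁻¹ *
        (b * ⁅a, diff b⁆ * b⁻¹) := by
      rw [diff, hσ]
      simp only [commutatorElement_def]
      group
    rw [h]
    refine mul (conj (conj ?_ ha) (ha.comm hb).inv) (conj ?_ hb)
    · have := iha.comm (hb.mul (ihb.of_le (Nat.le_succ _)))
      exact this.of_le (by omega)
    · exact (ha.comm ihb).of_le (by omega)
  | mono _ ih => exact ih.mono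

theorem iterate_diff_mem (h : IsPolySeq s f) (k : ℕ) : IsPolySeq (s + k) (diff^[k] f) := by
  induction k with
  | zero => exact h
  | succ k ih =>
    rw [Function.iterate_succ_apply']
    exact ih.diff_mem

/-- A commutator of `c` powers has weight `c - 1` and one of `c` constants has weight `2 * c - 1`.
So weight `s` needs at least `(s + 1) / 2` entries, which gives the term `s / 2` when terms are
counted from `0`. -/
theorem apply_mem (h : IsPolySeq s f) (n : ℕ) :
    f n ∈ (⊤ : Subgroup X).lowerCentralSeries (s / 2) := by
  induction h with
  | pow g => exact Subgroup.mem_top _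
  | const g => exact Subgroup.mem_top _
  | one s => exact one_mem _
  | mul _ _ iha ihb => exact mul_mem iha ihb
  | inv _ ih => exact inv_mem ih
  | @comm s t a b _ _ iha ihb =>
    have := commutator_lowerCentralSeries_le (s / 2) (t / 2)
      (Subgroup.commutator_mem_commutator iha ihb)
    exact Subgroup.lowerCentralSeries_antitone ⊤ (by omega) this
  | mono _ ih => exact Subgroup.lowerCentralSeries_antitone ⊤ (by omega) ih

theorem iterate_diff_eq_one [Group.IsNilpotent X] (h : IsPolySeq s f) :
    ∃ k, diff^[k] f = 1 := by
  obtain ⟨c, hc⟩ := (Subgroup.nilpotent_iff_lowerCentralSeries (G := X)).mp inferInstance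
  refine ⟨2 * c, funext fun n => ?_⟩
  have := (h.iterate_diff_mem (2 * c)).apply_mem n
  have := Subgroup.lowerCentralSeries_antitone ⊤ (show c ≤ (s + 2 * c) / 2 by omega) this
  rw [hc] at this
  exact this

/-- The polynomial sequences of a group form a group. -/
def subgroup (X : Type u) [Group X] : Subgroup (ℕ → X) where
  carrier := {f | IsPolySeq 0 f}
  mul_mem' := mul
  one_mem' := one 0
  inv_mem' := inv

end IsPolySeq

/-- A polynomial sequence in a torsion-free abelian group that vanishes infinitely often
vanishes. -/
theorem eq_zero_of_iterate_fwdDiff_eq_zero {M : Type u} [AddCommGroup M] [Module.IsTorsionFree ℤ M]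
    {f : ℕ → M} {k : ℕ} (hk : (fwdDiff 1)^[k] f = 0) (hf : {n | f n = 0}.Infinite) : f = 0 := by
  have hk' : ∀ j, k ≤ j → (fwdDiff 1)^[j] f 0 = 0 := fun j hj => by
    obtain ⟨i, rfl⟩ := Nat.exists_eq_add_of_le hj
    rw [add_comm, Function.iterate_add_apply, hk]
    clear hj
    have : (fwdDiff 1)^[i] (0 : ℕ → M) = 0 := by
      induction i with
      | zero => rfl
      | succ i ih =>
        rw [Function.iterate_succ_apply', ih]
        funext n
        simp [fwdDiff]
    rw [this]
    rfl
  set a : ℕ → M := fun j => (fwdDiff 1)^[j] f 0 with ha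
  -- Newton's expansion, cut off at `k` because the higher differences vanish.
  have hsum : ∀ n, f n = ∑ j ∈ Finset.range k, n.choose j • a j := fun n => by
    have h := shift_eq_sum_fwdDiff_iter 1 f n 0
    simp only [smul_eq_mul, mul_one, zero_add] at h
    rw [h]
    rcases le_total (n + 1) k with hnk | hnk
    · refine Finset.sum_subset (Finset.range_mono hnk) fun j _ hj => ?_
      rw [Nat.choose_eq_zero_of_lt (by simpa using hj), zero_smul]
    · refine (Finset.sum_subset (Finset.range_mono hnk) fun j _ hj => ?_).symm
      rw [hk' j (by simpa using hj), smul_zero]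
  -- All values lie in a finitely generated torsion-free, hence free, module. Each coordinate of `f`
  -- is then a rational polynomial with infinitely many roots.
  let N : Submodule ℤ M := Submodule.span ℤ (a '' (Finset.range k : Set ℕ))
  have haN : ∀ j ∈ Finset.range k, a j ∈ N := fun j hj =>
    Submodule.subset_span (Set.mem_image_of_mem _ hj)
  have hfN : ∀ n, f n ∈ N := fun n => by
    rw [hsum]
    exact Submodule.sum_mem _ fun j hj => N.nsmul_mem (haN j hj) _
  have : Module.Finite ℤ N := Module.Finite.span_of_finite ℤ ((Finset.finite_toSet _).image _)
  let B := Module.Free.chooseBasis ℤ N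
  have key : ∀ n, (⟨f n, hfN n⟩ : N) = 0 := fun n => by
    refine B.ext_elem fun i => ?_
    let l : N →ₗ[ℤ] ℤ := B.coord i
    let a' : ℕ → N := fun j => if h : j ∈ Finset.range k then ⟨a j, haN j h⟩ else 0
    let P : Polynomial ℚ := ∑ j ∈ Finset.range k,
      Polynomial.C ((l (a' j) : ℚ) / (j.factorial : ℚ)) * descPochhammer ℚ j
    have hP : ∀ m : ℕ, P.eval (m : ℚ) = (l ⟨f m, hfN m⟩ : ℚ) := fun m => by
      have h1 : (⟨f m, hfN m⟩ : N) = ∑ j ∈ Finset.range k, m.choose j • a' j := by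
        apply Subtype.ext
        change f m = _
        rw [hsum m, AddSubmonoidClass.coe_finsetSum]
        refine Finset.sum_congr rfl fun j hj => ?_
        simp only [a', dif_pos hj]
        rfl
      rw [h1, map_sum, Polynomial.eval_finsetSum]
      push_cast
      refine Finset.sum_congr rfl fun j _ => ?_
      rw [map_nsmul, Polynomial.eval_mul, Polynomial.eval_C, descPochhammer_eval_eq_descFactorial,
        Nat.descFactorial_eq_factorial_mul_choose]
      have := Nat.factorial_ne_zero j
      push_cast
      field_simp
      simp [mul_comm]
    have hP0 : P = 0 := by
      apply Polynomial.eq_zero_of_infinite_isRoot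
      refine (hf.image (Nat.cast_injective (R := ℚ)).injOn).mono ?_
      rintro _ ⟨m, hm, rfl⟩
      show P.eval (m : ℚ) = 0
      have hm0 : (⟨f m, hfN m⟩ : N) = 0 := Subtype.ext hm
      rw [hP, hm0, map_zero, Int.cast_zero]
    have := hP n
    rw [hP0, Polynomial.eval_zero] at this
    have hl : l ⟨f n, hfN n⟩ = 0 := by exact_mod_cast this.symm
    simpa [l] using hl
  funext n
  exact congrArg Subtype.val (key n)

namespace IsPolySeq

variable {X : Type u} [Group X] {f : ℕ → X}

open scoped IsMulCommutative in
-- For central values the multiplicative differences are the additive differences in the center, so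
-- nilpotency makes an iterated one vanish and the abelian case applies.
theorem eq_one_of_central [Group.IsNilpotent X]
    (hX : ∀ x ∈ Subgroup.center X, ∀ n : ℕ, 0 < n → x ^ n = 1 → x = 1)
    (hf : IsPolySeq 0 f) (hc : ∀ n, f n ∈ Subgroup.center X) (h : {n | f n = 1}.Infinite) :
    f = 1 := by
  let g : ℕ → Additive (Subgroup.center X) := fun n => Additive.ofMul ⟨f n, hc n⟩
  have hdiff : ∀ (k : ℕ) (n : ℕ),
      (((fwdDiff 1)^[k] g n).toMul : X) = diff^[k] f n := fun k => by
    induction k with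
    | zero => exact fun n => rfl
    | succ k ih =>
      intro n
      rw [Function.iterate_succ_apply', Function.iterate_succ_apply', fwdDiff]
      simp only [toMul_sub, Subgroup.coe_div, ih, diff, Pi.mul_apply, Pi.inv_apply]
      rw [div_eq_mul_inv]
      rw [← ih n, ← Subgroup.coe_inv]
      exact ((Subgroup.mem_center_iff.mp (Subtype.prop _)) _)
  obtain ⟨k, hk⟩ := hf.iterate_diff_eq_one
  have htf : Module.IsTorsionFree ℤ (Additive (Subgroup.center X)) := by
    have : IsMulTorsionFree (Subgroup.center X) := by
      refine ⟨fun n hn x y hxy => ?_⟩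
      have hxy' : x ^ n = y ^ n := hxy
      rw [← div_eq_one]
      apply Subtype.ext
      refine hX _ (Subtype.prop _) n (Nat.pos_of_ne_zero hn) ?_
      have : (x / y) ^ n = 1 := by rw [div_pow, hxy', div_self']
      exact congrArg Subtype.val this
    infer_instance
  have hg : g = 0 := by
    refine eq_zero_of_iterate_fwdDiff_eq_zero (k := k) (funext fun n => ?_) (h.mono fun n hn => ?_)
    · apply Additive.toMul.injective
      apply Subtype.ext
      rw [hdiff, hk]
      rfl
    · exact congrArg Additive.ofMul (Subtype.ext hn)
  funext n
  exact congrArg (fun x : Additive (Subgroup.center X) => (x.toMul : X)) (congrFun hg n)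

/-- A polynomial sequence in a torsion-free nilpotent group that is trivial infinitely often is
trivial. -/
theorem eq_one_of_infinite [Group.IsNilpotent X]
    (hX : ∀ x ∈ Subgroup.center X, ∀ n : ℕ, 0 < n → x ^ n = 1 → x = 1)
    (hf : IsPolySeq 0 f) (h : {n | f n = 1}.Infinite) : f = 1 := by
  obtain ⟨c, hc⟩ := Group.IsNilpotent.nilpotent X
  suffices H : ∀ (j : ℕ) (f : ℕ → X), IsPolySeq 0 f → {n | f n = 1}.Infinite →
      (∀ n, f n ∈ Subgroup.upperCentralSeries X j) → f = 1 from
    H c f hf h fun n => by rw [hc]; exact Subgroup.mem_top _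
  -- Induction along the upper central series: commutators of `f` with constants are polynomial, lie
  -- one term lower and vanish infinitely often. Hence they are trivial and `f` takes central
  -- values.
  intro j
  induction j with
  | zero => exact fun f _ _ hj => funext fun n => hj n
  | succ j ih =>
    intro f hf h hj
    refine eq_one_of_central hX hf (fun n => ?_) h
    rw [Subgroup.mem_center_iff]
    intro x
    have := ih ⁅f, fun _ => x⁆ ((hf.comm (const x)).of_le (Nat.zero_le _)) (h.mono fun n hn => ?_)
      (fun n => (Subgroup.mem_upperCentralSeries_succ_iff).mp (hj n) x)
    · exact (commutatorElement_eq_one_iff_mul_comm.mp (congrFun this n)).symm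
    · show ⁅f n, x⁆ = 1
      rw [hn, commutatorElement_one_left]

end IsPolySeq

/-! ### Torsion in nilpotent groups -/

theorem commutatorElement_pow_left {X : Type*} [Group X] {a b : X} (h : ∀ x, Commute ⁅a, b⁆ x)
    (n : ℕ) : ⁅a ^ n, b⁆ = ⁅a, b⁆ ^ n := by
  induction n with
  | zero => simp
  | succ n ih =>
    rw [pow_succ, commutatorElement_mul_left_eq_conj_mul, ih, ← (h _).eq, mul_assoc, mul_assoc,
      mul_inv_cancel_left, ← pow_succ']

theorem commute_mk_of_mem_lowerCentralSeries {X : Type*} [Group X] {i : ℕ} {x : X}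
    (hx : x ∈ (⊤ : Subgroup X).lowerCentralSeries i)
    (y : X ⧸ (⊤ : Subgroup X).lowerCentralSeries (i + 1)) : Commute (QuotientGroup.mk x) y := by
  induction y using QuotientGroup.induction_on with
  | H y =>
    rw [← commutatorElement_eq_one_iff_commute]
    exact (QuotientGroup.eq_one_iff ⁅x, y⁆).mpr
      (Subgroup.commutator_mem_commutator hx (Subgroup.mem_top y))

/-- A nilpotent group that is generated by elements of exponent `e` has exponent a power
of `e`. -/
theorem exists_pow_pow_eq_one_of_closure_eq_top {X : Type*} [Group X] [Group.IsNilpotent X]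
    {S : Set X}
    (hS : Subgroup.closure S = ⊤) {e : ℕ} (he : ∀ s ∈ S, s ^ e = 1) :
    ∃ c : ℕ, ∀ x : X, x ^ e ^ c = 1 := by
  set γ := (⊤ : Subgroup X).lowerCentralSeries with hγ
  -- Closure under products holds because `γ i` is central modulo `γ (i + 1)`. Once `γ i ≤ P i`,
  -- each `e`-th power descends one term of the series.
  let P : ℕ → Subgroup X := fun i =>
    { carrier := {x | x ∈ γ i ∧ x ^ e ∈ γ (i + 1)}
      mul_mem' := by
        rintro x y ⟨hx, hxe⟩ ⟨hy, hye⟩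
        refine ⟨mul_mem hx hy, ?_⟩
        rw [← QuotientGroup.eq_one_iff] at hxe hye ⊢
        rw [QuotientGroup.mk_pow] at hxe hye ⊢
        rw [QuotientGroup.mk_mul, (commute_mk_of_mem_lowerCentralSeries hx _).mul_pow, hxe, hye,
          mul_one]
      one_mem' := ⟨one_mem _, by rw [one_pow]; exact one_mem _⟩
      inv_mem' := by
        rintro x ⟨hx, hxe⟩
        exact ⟨inv_mem hx, by rw [inv_pow]; exact inv_mem hxe⟩ }
  have hP : ∀ i, γ i ≤ P i := fun i => by
    induction i with
    | zero =>
      show ⊤ ≤ P 0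
      rw [← hS, Subgroup.closure_le]
      exact fun s hs => ⟨Subgroup.mem_top s, by rw [he s hs]; exact one_mem _⟩
    | succ i ih =>
      show ⁅γ i, (⊤ : Subgroup X)⁆ ≤ _
      rw [Subgroup.commutator_le]
      intro a ha b _
      have hab : ⁅a, b⁆ ∈ γ (i + 1) := Subgroup.commutator_mem_commutator ha (Subgroup.mem_top b)
      refine ⟨hab, ?_⟩
      have h : ⁅a ^ e, b⁆ ∈ γ (i + 1 + 1) :=
        Subgroup.commutator_mem_commutator (ih ha).2 (Subgroup.mem_top b)
      rw [← QuotientGroup.eq_one_iff] at h ⊢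
      rw [← h]
      refine (commutatorElement_pow_left (a := (a : X ⧸ γ (i + 1 + 1))) (b := b)
        (fun y => ?_) e).symm
      exact commute_mk_of_mem_lowerCentralSeries hab y
  obtain ⟨c, hc⟩ := (Subgroup.nilpotent_iff_lowerCentralSeries (G := X)).mp inferInstance
  refine ⟨c, fun x => ?_⟩
  have hx : ∀ i, x ^ e ^ i ∈ γ i := fun i => by
    induction i with
    | zero => exact Subgroup.mem_top _
    | succ i ih =>
      rw [pow_succ, pow_mul]
      exact (hP i ih).2
  have := hx c
  rw [hγ, hc] at this
  exact this

theorem exists_pow_eq_one_of_finite {X : Type*} [Group X] [Group.IsNilpotent X] {S : Set X}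
    (hS : Subgroup.closure S = ⊤) (hfin : S.Finite) (h : ∀ s ∈ S, IsOfFinOrder s) :
    ∃ e : ℕ, 0 < e ∧ ∀ x : X, x ^ e = 1 := by
  obtain ⟨c, hc⟩ := exists_pow_pow_eq_one_of_closure_eq_top hS (e := ∏ s ∈ hfin.toFinset, orderOf s)
    fun s hs => orderOf_dvd_iff_pow_eq_one.mp
      (Finset.dvd_prod_of_mem orderOf (hfin.mem_toFinset.mpr hs))
  exact ⟨_, pow_pos (Finset.prod_pos fun s hs => (h s (hfin.mem_toFinset.mp hs)).orderOf_pos) c, hc⟩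

theorem isOfFinOrder_of_mem_torsionSubgroup {X : Type*} [Group X] [Group.IsNilpotent X] {x : X}
    (hx : x ∈ torsionSubgroup X) : IsOfFinOrder x := by
  refine Subgroup.closure_induction (p := fun x _ => IsOfFinOrder x) (fun x hx => hx)
    IsOfFinOrder.one (fun x y _ _ hx hy => ?_) (fun x _ hx => hx.inv) hx
  -- The subgroup generated by `x` and `y` has finite exponent, and it contains `x * y`.
  let T : Set X := {x, y}
  obtain ⟨e, he, h⟩ := exists_pow_eq_one_of_finite (Subgroup.closure_closure_coe_preimage (k := T))
    ((Set.toFinite T).preimage Subtype.val_injective.injOn) (by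
      rintro ⟨s, hs'⟩ (hs : s = x ∨ s = y)
      rw [← Submonoid.isOfFinOrder_coe (H := (Subgroup.closure T).toSubmonoid)]
      rcases hs with rfl | rfl
      · exact hx
      · exact hy)
  have hxy : x * y ∈ Subgroup.closure T := mul_mem (Subgroup.subset_closure (Or.inl rfl))
    (Subgroup.subset_closure (Or.inr rfl))
  exact isOfFinOrder_iff_pow_eq_one.mpr ⟨e, he, congrArg Subtype.val (h ⟨x * y, hxy⟩)⟩

theorem mem_torsionSubgroup_iff {X : Type*} [Group X] [Group.IsNilpotent X] {x : X} :
    x ∈ torsionSubgroup X ↔ IsOfFinOrder x :=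
  ⟨isOfFinOrder_of_mem_torsionSubgroup, fun h => Subgroup.subset_closure h⟩

theorem eq_one_of_pow_eq_one_quotient_torsionSubgroup {X : Type*} [Group X] [Group.IsNilpotent X]
    {x : X ⧸ torsionSubgroup X} {n : ℕ} (hn : 0 < n) (h : x ^ n = 1) : x = 1 := by
  induction x using QuotientGroup.induction_on with
  | H x =>
    rw [← QuotientGroup.mk_pow, QuotientGroup.eq_one_iff, mem_torsionSubgroup_iff] at h
    rw [QuotientGroup.eq_one_iff, mem_torsionSubgroup_iff]
    exact h.of_pow hn.ne'

/-! ### Generation of nilpotent groups modulo commutators -/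

/-- A subgroup of a nilpotent group that covers the abelianization is the whole group. -/
theorem eq_top_of_sup_commutator_eq_top {X : Type*} [Group X] [Group.IsNilpotent X]
    {H : Subgroup X} (h : H ⊔ commutator X = ⊤) : H = ⊤ := by
  set γ := (⊤ : Subgroup X).lowerCentralSeries with hγ
  have key : ∀ i, H ⊔ γ i = ⊤ := fun i => by
    induction i with
    | zero => exact sup_top_eq H
    | succ i ih =>
      -- `K` is normalized by `H` and by `γ i`, which together generate the group. Modulo `K` the
      -- factor from `H` dies and the factor from `γ i` is central, so the quotient is abelian and
      -- `K` contains the commutator subgroup.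
      set K := H ⊔ γ (i + 1) with hK
      have hcomm : ∀ z ∈ γ i, ∀ x : X, ⁅z, x⁆ ∈ K := fun z hz x =>
        (le_sup_right : _ ≤ K) (Subgroup.commutator_mem_commutator hz (Subgroup.mem_top x))
      have hnorm : Subgroup.normalizer (K : Set X) = ⊤ := by
        rw [eq_top_iff, ← ih, sup_le_iff]
        refine ⟨le_sup_left.trans Subgroup.le_normalizer, ?_⟩
        rw [Subgroup.le_normalizer_iff_commutator_le_right, Subgroup.commutator_le]
        exact fun z hz x _ => hcomm z hz x
      have : K.Normal := Subgroup.normalizer_eq_top_iff.mp hnorm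
      rw [eq_top_iff, ← h, sup_le_iff]
      refine ⟨le_sup_left, ?_⟩
      rw [commutator_def, Subgroup.commutator_le]
      intro x _ y _
      obtain ⟨a, ha, z, hz, rfl⟩ := Subgroup.mem_sup_of_normal_right.mp
        (show x ∈ H ⊔ γ i by rw [ih]; exact Subgroup.mem_top x)
      have ha1 : (a : X ⧸ K) = 1 := (QuotientGroup.eq_one_iff a).mpr ((le_sup_left : H ≤ K) ha)
      have hz1 := (QuotientGroup.eq_one_iff _).mpr (hcomm z hz y)
      rw [← QuotientGroup.eq_one_iff, ← hz1]
      show ⁅(a : X ⧸ K) * z, (y : X ⧸ K)⁆ = ⁅(z : X ⧸ K), (y : X ⧸ K)⁆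
      rw [ha1, one_mul]
  obtain ⟨c, hc⟩ := (Subgroup.nilpotent_iff_lowerCentralSeries (G := X)).mp inferInstance
  have := key c
  rwa [hγ, hc, sup_bot_eq] at this

/-- The family `t` generates the abelianization of `X` up to finite exponent. -/
def GeneratesUpToExponent {ι : Type*} {X : Type u} [Group X] (t : ι → X) : Prop :=
  ∃ m : ℕ, 0 < m ∧ ∀ x : X, x ^ m ∈ Subgroup.closure (Set.range t) ⊔ commutator X

/-- In the quotient `M` of the abelianization by the `s i`, each `t i` becomes a square. So,
additively, `M = 2M` with `M` finitely generated, and Nakayama's lemma gives an odd, hence nonzero,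
integer that kills `M`. -/
theorem generatesUpToExponent_of_eq_mul_sq {ι : Type*} [Finite ι] {X : Type*} [Group X]
    {t s z : ι → X} (ht : Subgroup.closure (Set.range t) = ⊤) (h : ∀ i, s i = t i * z i ^ 2) :
    GeneratesUpToExponent s := by
  set H := Subgroup.closure (Set.range s) ⊔ commutator X with hH
  have hHn : H.Normal := Subgroup.Normal.of_commutator_le X le_sup_right
  let _ : CommGroup (X ⧸ H) :=
    { (inferInstance : Group (X ⧸ H)) with
      mul_comm := by
        intro a b
        induction a using QuotientGroup.induction_on with
        | H a =>
          induction b using QuotientGroup.induction_on with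
          | H b =>
            rw [← commutatorElement_eq_one_iff_mul_comm]
            exact (QuotientGroup.eq_one_iff ⁅a, b⁆).mpr ((le_sup_right : _ ≤ H)
              (Subgroup.commutator_mem_commutator (Subgroup.mem_top a) (Subgroup.mem_top b))) }
  have hfg : Group.FG (X ⧸ H) := by
    have : Group.FG X := Group.fg_iff.mpr ⟨_, ht, Set.finite_range t⟩
    exact QuotientGroup.fg H
  have hM : AddGroup.FG (Additive (X ⧸ H)) := inferInstance
  have hM' : Module.Finite ℤ (Additive (X ⧸ H)) := Module.Finite.iff_addGroup_fg.mpr hM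
  have hsq : ∀ x : X, ∃ y : X ⧸ H, (x : X ⧸ H) = y ^ 2 := fun x => by
    suffices hx : (⊤ : Subgroup X) ≤ (powMonoidHom 2 : X ⧸ H →* X ⧸ H).range.comap
        (QuotientGroup.mk' H) by
      obtain ⟨y, hy⟩ := hx (Subgroup.mem_top x)
      exact ⟨y, hy.symm⟩
    rw [← ht, Subgroup.closure_le]
    rintro _ ⟨i, rfl⟩
    refine ⟨((z i : X ⧸ H))⁻¹, ?_⟩
    have h1 : (s i : X ⧸ H) = 1 := (QuotientGroup.eq_one_iff _).mpr
      ((le_sup_left : _ ≤ H) (Subgroup.subset_closure ⟨i, rfl⟩))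
    rw [h, QuotientGroup.mk_mul, QuotientGroup.mk_pow] at h1
    show ((z i : X ⧸ H))⁻¹ ^ 2 = (t i : X ⧸ H)
    rw [inv_pow]
    exact (eq_inv_of_mul_eq_one_left h1).symm
  obtain ⟨r, hr, hr0⟩ := Submodule.exists_sub_one_mem_and_smul_eq_zero_of_fg_of_le_smul
    (Ideal.span {(2 : ℤ)}) (⊤ : Submodule ℤ (Additive (X ⧸ H))) Module.Finite.fg_top (by
      intro x _
      obtain ⟨x', hx'⟩ := QuotientGroup.mk_surjective x.toMul
      obtain ⟨y, hy⟩ := hsq x'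
      have : x = (2 : ℤ) • Additive.ofMul y := by
        apply Additive.toMul.injective
        rw [← hx', hy]
        exact (zpow_natCast y 2).symm
      rw [this]
      exact Submodule.smul_mem_smul (Ideal.mem_span_singleton_self 2) Submodule.mem_top)
  have hr1 : r ≠ 0 := by
    rintro rfl
    rw [Ideal.mem_span_singleton] at hr
    omega
  refine ⟨r.natAbs, Int.natAbs_pos.mpr hr1, fun x => ?_⟩
  have hx : (x : X ⧸ H) ^ r = 1 := hr0 (Additive.ofMul (x : X ⧸ H)) Submodule.mem_top
  show _ ∈ H
  rw [← QuotientGroup.eq_one_iff, QuotientGroup.mk_pow, ← zpow_natCast]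
  rcases Int.natAbs_eq r with h' | h'
  · rw [← h', hx]
  · rw [← inv_eq_one, ← zpow_neg, ← h', hx]

/-! ### Generic tuples -/

theorem inv_lift_mul_lift_mem {ι : Type*} {X : Type*} [Group X] {K : Subgroup X} [K.Normal]
    {g h : ι → X} (hgh : ∀ i, (g i)⁻¹ * h i ∈ K) (w : FreeGroup ι) :
    (FreeGroup.lift g w)⁻¹ * FreeGroup.lift h w ∈ K := by
  have : (QuotientGroup.mk' K).comp (FreeGroup.lift g) =
      (QuotientGroup.mk' K).comp (FreeGroup.lift h) := by
    refine FreeGroup.ext_hom _ _ fun i => ?_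
    simpa using QuotientGroup.eq.mpr (hgh i)
  exact QuotientGroup.eq.mp (DFunLike.congr_fun this w)

theorem lift_comp_lift {ι κ : Type*} {X : Type*} [Group X] (g : κ → X) (β : ι → FreeGroup κ)
    (w : FreeGroup ι) :
    FreeGroup.lift g (FreeGroup.lift β w) = FreeGroup.lift (fun i => FreeGroup.lift g (β i)) w := by
  have : (FreeGroup.lift g).comp (FreeGroup.lift β) =
      FreeGroup.lift (fun i => FreeGroup.lift g (β i)) := by
    refine FreeGroup.ext_hom _ _ fun i => ?_
    simp
  exact DFunLike.congr_fun this w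

theorem lift_pi_apply {ι κ : Type*} {X : Type*} [Group X] (p : ι → κ → X) (w : FreeGroup ι) (b : κ) :
    FreeGroup.lift p w b = FreeGroup.lift (fun i => p i b) w := by
  have : (Pi.evalMonoidHom (fun _ : κ => X) b).comp (FreeGroup.lift p) =
      FreeGroup.lift (fun i => p i b) := by
    refine FreeGroup.ext_hom _ _ fun i => ?_
    simp
  exact DFunLike.congr_fun this w

theorem IsPolySeq.lift {ι : Type*} {X : Type*} [Group X] {p : ι → ℕ → X}
    (hp : ∀ i, IsPolySeq 0 (p i)) (w : FreeGroup ι) : IsPolySeq 0 (FreeGroup.lift p w) := by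
  have : (FreeGroup.lift p).range ≤ IsPolySeq.subgroup X :=
    FreeGroup.range_lift_le (by rintro _ ⟨i, rfl⟩; exact hp i)
  exact this ⟨w, rfl⟩

/-- Every tuple that is obtained from `g` by an epimorphism between free groups and a modification
by commutators satisfies one of the words in `W`. -/
def AlwaysSatisfies {m : ℕ} {X : Type u} [Group X] (W : Finset (FreeGroup (Fin m)))
    (g : Fin m → X) : Prop :=
  ∀ α : Fin m → FreeGroup (Fin m), Subgroup.closure (Set.range α) = ⊤ →
    ∀ c : Fin m → X, (∀ i, c i ∈ commutator X) →
      ∃ w ∈ W, FreeGroup.lift (fun i => FreeGroup.lift g (α i) * c i) w = 1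

namespace AlwaysSatisfies

variable {m : ℕ} {X : Type u} [Group X] {W : Finset (FreeGroup (Fin m))} {g : Fin m → X}

/-- Surjections of the free group compose, and the changes by commutators collect into a single
commutator factor on the right. -/
theorem trans (hg : AlwaysSatisfies W g) {β : Fin m → FreeGroup (Fin m)}
    (hβ : Subgroup.closure (Set.range β) = ⊤) {c : Fin m → X} (hc : ∀ i, c i ∈ commutator X) :
    AlwaysSatisfies W (fun i => FreeGroup.lift g (β i) * c i) := by
  intro α hα d hd
  have hsurj : Function.Surjective (FreeGroup.lift β) :=
    FreeGroup.lift_surjective_iff_closure_range_eq_top.mpr hβ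
  have := hg (fun i => FreeGroup.lift β (α i)) (by
    have hr : Set.range (fun i => FreeGroup.lift β (α i)) = FreeGroup.lift β '' Set.range α :=
      Set.range_comp _ _
    rw [hr, ← MonoidHom.map_closure, hα, Subgroup.map_top_of_surjective _ hsurj])
    (fun i => (FreeGroup.lift (fun i => FreeGroup.lift g (β i)) (α i))⁻¹ *
      FreeGroup.lift (fun i => FreeGroup.lift g (β i) * c i) (α i) * d i) (fun i =>
      mul_mem (inv_lift_mul_lift_mem (fun j => by simpa using hc j) _) (hd i))
  obtain ⟨w, hw, h⟩ := this
  refine ⟨w, hw, ?_⟩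
  rw [← h]
  congr 2
  funext i
  rw [lift_comp_lift]
  group

/-- For fixed `α` and `c`, each word gives a polynomial sequence in `b`. By the pigeonhole principle
on the finite set `W`, one word is trivial infinitely often, hence for all `b`. -/
theorem of_infinite [Group.IsNilpotent X]
    (hX : ∀ (x : X) (n : ℕ), 0 < n → x ^ n = 1 → x = 1) {p : Fin m → ℕ → X}
    (hp : ∀ i, IsPolySeq 0 (p i)) (h : {b | AlwaysSatisfies W (fun i => p i b)}.Infinite) (b : ℕ) :
    AlwaysSatisfies W (fun i => p i b) := by
  intro α hα c hc
  let f : FreeGroup (Fin m) → ℕ → X := fun w =>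
    FreeGroup.lift (fun i => FreeGroup.lift p (α i) * fun _ => c i) w
  have hf : ∀ w, IsPolySeq 0 (f w) := fun w =>
    IsPolySeq.lift (fun i => (IsPolySeq.lift hp _).mul (IsPolySeq.const (c i)).mono) w
  have hfb : ∀ w b, f w b =
      FreeGroup.lift (fun i => FreeGroup.lift (fun i => p i b) (α i) * c i) w := fun w b => by
    simp only [f, lift_pi_apply, Pi.mul_apply]
  have hsub : {b | AlwaysSatisfies W (fun i => p i b)} ⊆ ⋃ w ∈ W, {b | f w b = 1} := fun b hb => by
    obtain ⟨w, hw, h⟩ := hb α hα c hc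
    exact Set.mem_biUnion hw (by rw [Set.mem_ofPred_eq, hfb, h])
  have hinf : ∃ w ∈ W, {b | f w b = 1}.Infinite := by
    by_contra! hfin
    refine h ((W.finite_toSet.biUnion fun w hw => ?_).subset hsub)
    exact hfin w hw
  obtain ⟨w, hw, hinf⟩ := hinf
  refine ⟨w, hw, ?_⟩
  rw [← hfb, IsPolySeq.eq_one_of_infinite (fun x _ => hX x) (hf w) hinf]
  rfl

end AlwaysSatisfies

theorem infinite_of_forall_mul {m : ℕ} (hm : 0 < m) {P : ℕ → Prop} (h : ∀ a, P (m * a)) :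
    {b | P b}.Infinite :=
  (Set.infinite_range_of_injective (mul_right_injective₀ hm.ne')).mono
    (by rintro _ ⟨a, rfl⟩; exact h a)

theorem isPolySeq_cons {n : ℕ} {X : Type*} [Group X] {a : ℕ → X} {p : Fin n → ℕ → X}
    (ha : IsPolySeq 0 a) (hp : ∀ i, IsPolySeq 0 (p i)) (j : Fin (n + 1)) :
    IsPolySeq 0 (Fin.cons (α := fun _ => ℕ → X) a p j) := by
  cases j using Fin.cases with
  | zero => exact ha
  | succ j => exact hp j

theorem cons_apply_eq {n : ℕ} {X : Type*} (a : ℕ → X) (p : Fin n → ℕ → X) (b : ℕ) :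
    (fun i => Fin.cons (α := fun _ => ℕ → X) a p i b) =
      (Fin.cons (a b) (fun i => p i b) : Fin (n + 1) → X) := by
  funext j
  cases j using Fin.cases <;> rfl

namespace AlwaysSatisfies

variable {n : ℕ} {X : Type u} [Group X] [Group.IsNilpotent X]
  {W : Finset (FreeGroup (Fin (n + 1)))}

theorem cons_of_infinite (hX : ∀ (x : X) (n : ℕ), 0 < n → x ^ n = 1 → x = 1)
    {a : ℕ → X} {p : Fin n → ℕ → X} (ha : IsPolySeq 0 a) (hp : ∀ i, IsPolySeq 0 (p i))
    {m : ℕ} (hm : 0 < m)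
    (h : ∀ b, AlwaysSatisfies W (Fin.cons (a (m * b)) (fun i => p i (m * b)) : Fin (n + 1) → X))
    (b : ℕ) : AlwaysSatisfies W (Fin.cons (a b) (fun i => p i b) : Fin (n + 1) → X) := by
  have := of_infinite (W := W) hX (isPolySeq_cons ha hp)
    (infinite_of_forall_mul hm fun b => by rw [cons_apply_eq]; exact h b) b
  rwa [cons_apply_eq] at this

/-- Changing one entry of a tuple, as long as the new tuple generates up to finite exponent. -/
theorem update (hX : ∀ (x : X) (n : ℕ), 0 < n → x ^ n = 1 → x = 1) {t : Fin n → X}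
    (ht : ∀ u : X, AlwaysSatisfies W (Fin.cons u t : Fin (n + 1) → X)) (i : Fin n) (v : X)
    (h : GeneratesUpToExponent (Function.update t i (t i * v))) (u : X) :
    AlwaysSatisfies W (Fin.cons u (Function.update t i (t i * v)) : Fin (n + 1) → X) := by
  obtain ⟨m, hm, h⟩ := h
  -- With first entry `v ^ m`, Nielsen moves multiply `t i` by `v ^ (m * a)`. Interpolation along `t
  -- i * v ^ b` from the multiples of `m` reaches `b = 1`.
  have step1 : AlwaysSatisfies W
      (Fin.cons (v ^ m) (Function.update t i (t i * v)) : Fin (n + 1) → X) := by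
    have := cons_of_infinite (W := W) hX (a := fun _ => v ^ m)
      (p := fun j b => Function.update t i (t i * v ^ b) j) (IsPolySeq.const _).mono (fun j => by
        by_cases hj : j = i
        · subst hj
          simp only [Function.update_self]
          exact (IsPolySeq.const (t j)).mono.mul (IsPolySeq.pow v)
        · simp only [Function.update_of_ne hj]
          exact (IsPolySeq.const (t j)).mono) hm (fun a => ?_) 1
    · simpa using this
    · let β : Fin (n + 1) → FreeGroup (Fin (n + 1)) :=
        Function.update FreeGroup.of i.succ (FreeGroup.of i.succ * FreeGroup.of 0 ^ a)
      have hβ0 : β 0 = FreeGroup.of 0 := Function.update_of_ne (Fin.succ_ne_zero i).symm _ _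
      have hβ : Subgroup.closure (Set.range β) = ⊤ := by
        rw [eq_top_iff, ← FreeGroup.closure_range_of, Subgroup.closure_le]
        have h0 : FreeGroup.of 0 ∈ Subgroup.closure (Set.range β) :=
          Subgroup.subset_closure ⟨0, hβ0⟩
        rintro _ ⟨j, rfl⟩
        by_cases hj : j = i.succ
        · have h1 : β i.succ ∈ Subgroup.closure (Set.range β) := Subgroup.subset_closure ⟨_, rfl⟩
          have h2 := mul_mem h1 (inv_mem (pow_mem h0 a))
          simp only [β, Function.update_self, mul_inv_cancel_right] at h2
          rw [hj]
          exact h2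
        · exact Subgroup.subset_closure ⟨j, Function.update_of_ne hj _ _⟩
      convert (ht (v ^ m)).trans hβ (c := 1) (fun _ => one_mem _) using 1
      funext j
      cases j using Fin.cases with
      | zero => simp [hβ0]
      | succ j =>
        by_cases hj : j = i
        · subst hj
          simp [β, pow_mul]
        · simp [β, hj]
  set s := Function.update t i (t i * v) with hs
  -- It remains to free the first entry. Since `m`-th powers lie in the subgroup generated by `s`
  -- and the commutators, `u ^ (m * e)` arises from `v ^ m` by a Nielsen move with letters from `s`
  -- and a commutator; interpolation in the exponent then reaches `u`.
  have := cons_of_infinite (W := W) hX (a := fun b => u ^ b) (p := fun j _ => s j)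
    (IsPolySeq.pow u) (fun j => (IsPolySeq.const (s j)).mono) hm (fun e => ?_) 1
  · simpa using this
  · obtain ⟨y, hy, c, hc, hyc⟩ := Subgroup.mem_sup_of_normal_right.mp
      (mul_mem (inv_mem (h v)) (pow_mem (h u) e))
    rw [← FreeGroup.range_lift_eq_closure] at hy
    obtain ⟨r, rfl⟩ := hy
    let r' : FreeGroup (Fin (n + 1)) := FreeGroup.lift (fun j : Fin n => FreeGroup.of j.succ) r
    let β : Fin (n + 1) → FreeGroup (Fin (n + 1)) :=
      Fin.cons (FreeGroup.of 0 * r') (fun j => FreeGroup.of j.succ)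
    have hβ : Subgroup.closure (Set.range β) = ⊤ := by
      rw [eq_top_iff, ← FreeGroup.closure_range_of, Subgroup.closure_le]
      have hsucc : ∀ j : Fin n, FreeGroup.of j.succ ∈ Subgroup.closure (Set.range β) :=
        fun j => Subgroup.subset_closure ⟨j.succ, rfl⟩
      rintro _ ⟨j, rfl⟩
      cases j using Fin.cases with
      | zero =>
        have hr' : r' ∈ Subgroup.closure (Set.range β) :=
          FreeGroup.range_lift_le (s := Subgroup.closure (Set.range β))
            (by rintro _ ⟨j, rfl⟩; exact hsucc j) ⟨r, rfl⟩
        have h1 : β 0 ∈ Subgroup.closure (Set.range β) := Subgroup.subset_closure ⟨_, rfl⟩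
        have h2 := mul_mem h1 (inv_mem hr')
        simp only [β, Fin.cons_zero, mul_inv_cancel_right] at h2
        exact h2
      | succ j => exact hsucc j
    convert step1.trans hβ (c := Fin.cons c 1) (fun j => by
      cases j using Fin.cases with
      | zero => exact hc
      | succ j => exact one_mem _) using 1
    funext j
    cases j using Fin.cases with
    | zero =>
      simp only [Fin.cons_zero, β, map_mul, FreeGroup.lift_apply_of, r', lift_comp_lift,
        Fin.cons_succ]
      rw [mul_assoc, hyc, mul_inv_cancel_left, pow_mul]
    | succ j => simp [β]

/-- If the tuples `(u, t)` have the property for a generating tuple `t`, then all tuples have. -/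
theorem of_generating (hX : ∀ (x : X) (n : ℕ), 0 < n → x ^ n = 1 → x = 1) {t : Fin n → X}
    (hgen : Subgroup.closure (Set.range t) = ⊤)
    (ht : ∀ u : X, AlwaysSatisfies W (Fin.cons u t : Fin (n + 1) → X)) (g : Fin n → X) (u : X) :
    AlwaysSatisfies W (Fin.cons u g : Fin (n + 1) → X) := by
  -- Entries are changed one at a time. Even exponents ensure that every intermediate tuple still
  -- generates up to finite exponent, as `update` requires.
  have even : ∀ (e : ℕ) (J : Finset (Fin n)) (u : X), AlwaysSatisfies W
      (Fin.cons u (fun i => t i * (if i ∈ J then ((t i)⁻¹ * g i) ^ (2 * e) else 1)) :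
        Fin (n + 1) → X) := by
    intro e J
    induction J using Finset.induction_on with
    | empty => simpa using ht
    | insert i J hi ih =>
      have hupd : (fun j => t j * (if j ∈ insert i J then ((t j)⁻¹ * g j) ^ (2 * e) else 1)) =
          Function.update (fun j => t j * (if j ∈ J then ((t j)⁻¹ * g j) ^ (2 * e) else 1)) i
            (t i * (if i ∈ J then ((t i)⁻¹ * g i) ^ (2 * e) else 1) *
              ((t i)⁻¹ * g i) ^ (2 * e)) := by
        funext j
        by_cases hj : j = i
        · subst hj
          simp [hi]
        · simp [hj]
      rw [hupd]
      refine update hX ih i _ ?_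
      rw [← hupd]
      refine generatesUpToExponent_of_eq_mul_sq hgen
        (z := fun j => if j ∈ insert i J then ((t j)⁻¹ * g j) ^ e else 1) fun j => ?_
      split_ifs
      · rw [← pow_mul, mul_comm e 2]
      · simp
  -- All entries now move simultaneously: from even `b` to `b = 1`, where the curve passes through
  -- `g`.
  have := cons_of_infinite (W := W) hX (a := fun _ => u)
    (p := fun i b => t i * ((t i)⁻¹ * g i) ^ b) (IsPolySeq.const u).mono
    (fun i => (IsPolySeq.const (t i)).mono.mul (IsPolySeq.pow _)) two_pos
    (fun e => by simpa using even e Finset.univ u) 1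
  simpa using this

end AlwaysSatisfies

/-- The tuples over a torsion-free nilpotent group are not a finite union of proper solution
sets of words. -/
theorem exists_forall_lift_ne_one {m : ℕ} {X : Type*} [Group X] [Group.IsNilpotent X]
    (hX : ∀ (x : X) (n : ℕ), 0 < n → x ^ n = 1 → x = 1) (W : Finset (FreeGroup (Fin m)))
    (hW : ∀ w ∈ W, ∃ g : Fin m → X, FreeGroup.lift g w ≠ 1) :
    ∃ g : Fin m → X, ∀ w ∈ W, FreeGroup.lift g w ≠ 1 := by
  classical
  induction W using Finset.induction_on with
  | empty => exact ⟨1, by simp⟩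
  | insert w₀ W _ ih =>
    obtain ⟨g, hg⟩ := ih fun w hw => hW w (Finset.mem_insert_of_mem hw)
    obtain ⟨h, hh⟩ := hW w₀ (Finset.mem_insert_self _ _)
    -- This curve joins `g` at `b = 0` to `h` at `b = 1`. Each word is nontrivial at one of these
    -- two points, so it vanishes for only finitely many `b`.
    let p : Fin m → ℕ → X := fun i b => g i * ((g i)⁻¹ * h i) ^ b
    have hp : ∀ i, IsPolySeq 0 (p i) := fun i =>
      (IsPolySeq.const (g i)).mono.mul (IsPolySeq.pow _)
    have hfin : ∀ w ∈ insert w₀ W, {b | FreeGroup.lift p w b = 1}.Finite := fun w hw => by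
      by_contra hinf
      have h1 := IsPolySeq.eq_one_of_infinite (fun x _ => hX x) (IsPolySeq.lift hp w) hinf
      rcases Finset.mem_insert.mp hw with rfl | hw
      · apply hh
        have := congrFun h1 1
        rw [lift_pi_apply] at this
        simpa [p] using this
      · apply hg w hw
        have := congrFun h1 0
        rw [lift_pi_apply] at this
        simpa [p] using this
    obtain ⟨b, hb⟩ := ((Finset.finite_toSet (insert w₀ W)).biUnion hfin).exists_notMem
    refine ⟨fun i => p i b, fun w hw h1 => hb (Set.mem_biUnion hw ?_)⟩
    rw [Set.mem_ofPred_eq, lift_pi_apply, h1]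

/-! ### Identities and verbal subgroups -/

theorem map_lift {ι : Type*} {X Y : Type*} [Group X] [Group Y] (φ : X →* Y) (g : ι → X)
    (w : FreeGroup ι) : φ (FreeGroup.lift g w) = FreeGroup.lift (fun i => φ (g i)) w := by
  have : φ.comp (FreeGroup.lift g) = FreeGroup.lift (fun i => φ (g i)) := by
    refine FreeGroup.ext_hom _ _ fun i => ?_
    simp
  exact DFunLike.congr_fun this w

theorem map_eq_one_of_mem_verbalSubgroup {G H : Type*} [Group G] [Group H] (f : H →* G) {x : H}
    (hx : x ∈ verbalSubgroup (groupVariety G) H) : f x = 1 := by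
  have : verbalSubgroup (groupVariety G) H ≤ f.ker := by
    rw [verbalSubgroup, Subgroup.closure_le]
    rintro _ ⟨w, hw, h, rfl⟩
    show f _ = 1
    rw [map_lift]
    exact hw _
  exact this hx

theorem mem_verbalSubgroup_of_forall_lift_eq_one {m : ℕ} {X : Type*} [Group X]
    {w : FreeGroup (Fin m)} (hw : ∀ g : Fin m → X, FreeGroup.lift g w = 1) :
    w ∈ verbalSubgroup (groupVariety X) (FreeGroup (Fin m)) := by
  refine Subgroup.subset_closure ⟨FreeGroup.lift (fun i : Fin m => FreeGroup.of (i : ℕ)) w,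
    fun g => ?_, fun i => if h : i < m then FreeGroup.of ⟨i, h⟩ else 1, ?_⟩
  · rw [lift_comp_lift]
    exact hw _
  · rw [lift_comp_lift]
    simp only [FreeGroup.lift_apply_of, Fin.is_lt, dite_true, Fin.eta]
    exact DFunLike.congr_fun (FreeGroup.lift_of_eq_id _) w

/-! ### Generic generating tuples -/

theorem exists_fin_generating {G : Type*} [Group G] [Group.FG G] {n : ℕ} (hn : Group.rank G ≤ n) :
    ∃ t : Fin n → G, Subgroup.closure (Set.range t) = ⊤ := by
  obtain ⟨S, hS, hgen⟩ := Group.rank_spec G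
  refine ⟨fun i => if h : (i : ℕ) < S.card then S.equivFin.symm ⟨i, h⟩ else 1, ?_⟩
  rw [eq_top_iff, ← hgen]
  refine Subgroup.closure_mono fun s hs => ⟨⟨S.equivFin ⟨s, hs⟩, ?_⟩, ?_⟩
  · have := (S.equivFin ⟨s, hs⟩).2
    omega
  · simp

theorem exists_surjective_forall_map_ne_one {G : Type u} [Group G] [Group.IsNilpotent G]
    [Group.FG G] {n : ℕ} (hn : Group.rank G ≤ n)
    (hV : groupVariety G = groupVariety (G ⧸ torsionSubgroup G))
    (W : Finset (FreeGroup (Fin (n + 1))))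
    (hW : ∀ w ∈ W, w ∉ verbalSubgroup (groupVariety G) (FreeGroup (Fin (n + 1)))) :
    ∃ f : FreeGroup (Fin (n + 1)) →* G, Function.Surjective f ∧ ∀ w ∈ W, f w ≠ 1 := by
  by_contra! hcon
  let π := QuotientGroup.mk' (torsionSubgroup G)
  have hπ : Function.Surjective π := QuotientGroup.mk'_surjective _
  have hX : ∀ (x : G ⧸ torsionSubgroup G) (n : ℕ), 0 < n → x ^ n = 1 → x = 1 :=
    fun x n hn h => eq_one_of_pow_eq_one_quotient_torsionSubgroup hn h
  have hcomm : commutator (G ⧸ torsionSubgroup G) = (commutator G).map π := by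
    rw [commutator_def, commutator_def, Subgroup.map_commutator,
      Subgroup.map_top_of_surjective _ hπ]
  obtain ⟨t, ht⟩ := exists_fin_generating hn
  have hgen : Subgroup.closure (Set.range fun i => π (t i)) = ⊤ := by
    have : Set.range (fun i => π (t i)) = π '' Set.range t := Set.range_comp _ _
    rw [this, ← MonoidHom.map_closure, ht, Subgroup.map_top_of_surjective _ hπ]
  -- The tuple lifts to `G`, the commutator factors to commutator factors. The lift generates `G`
  -- modulo commutators, hence generates `G`, and the assumption for contradiction applies to it.
  have hsat : ∀ u, AlwaysSatisfies W
      (Fin.cons u (fun i => π (t i)) : Fin (n + 1) → G ⧸ torsionSubgroup G) := by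
    intro u α hα c hc
    obtain ⟨u, rfl⟩ := hπ u
    rw [hcomm] at hc
    choose d hd hdc using hc
    let g : Fin (n + 1) → G := Fin.cons u t
    let h : Fin (n + 1) → G := fun i => FreeGroup.lift g (α i) * d i
    have hh : Subgroup.closure (Set.range h) = ⊤ := by
      apply eq_top_of_sup_commutator_eq_top
      have h1 : Subgroup.closure (Set.range α) ≤
          (Subgroup.closure (Set.range h) ⊔ commutator G).comap (FreeGroup.lift g) := by
        rw [Subgroup.closure_le]
        rintro _ ⟨i, rfl⟩
        have h2 : h i * (d i)⁻¹ ∈ Subgroup.closure (Set.range h) ⊔ commutator G :=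
          mul_mem ((le_sup_left : _ ≤ Subgroup.closure (Set.range h) ⊔ commutator G)
            (Subgroup.subset_closure ⟨i, rfl⟩))
            ((le_sup_right : _ ≤ Subgroup.closure (Set.range h) ⊔ commutator G) (inv_mem (hd i)))
        simpa [h] using h2
      rw [hα, top_le_iff] at h1
      rw [eq_top_iff, ← ht, Subgroup.closure_le]
      rintro _ ⟨i, rfl⟩
      have h3 : FreeGroup.of i.succ ∈
          (Subgroup.closure (Set.range h) ⊔ commutator G).comap (FreeGroup.lift g) := by
        rw [h1]
        exact Subgroup.mem_top _
      simpa [g] using h3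
    obtain ⟨w, hw, hw1⟩ := hcon (FreeGroup.lift h)
      (FreeGroup.lift_surjective_iff_closure_range_eq_top.mpr hh)
    refine ⟨w, hw, ?_⟩
    have h4 := congrArg π hw1
    rw [map_lift, map_one] at h4
    rw [← h4]
    congr 2
    funext i
    rw [← hdc, map_mul, map_lift]
    congr 3
    funext j
    cases j using Fin.cases <;> rfl
  obtain ⟨g, hg⟩ := exists_forall_lift_ne_one hX W fun w hw => by
    by_contra! h
    apply hW w hw
    rw [hV]
    exact mem_verbalSubgroup_of_forall_lift_eq_one h
  obtain ⟨w, hw, h⟩ := AlwaysSatisfies.of_generating hX hgen hsat (Fin.tail g) (g 0)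
    FreeGroup.of (FreeGroup.closure_range_of _) 1 (fun _ => one_mem _)
  exact hg w hw (by simpa using h)

theorem exists_surjective_forall_map_eq_one_iff {G : Type u} [Group G] [Group.IsNilpotent G]
    [Group.FG G] {N : ℕ} (hN : Group.rank G < N)
    (hV : groupVariety G = groupVariety (G ⧸ torsionSubgroup G))
    {W : Set (FreeGroup (Fin N))} (hW : W.Finite) :
    ∃ f : FreeGroup (Fin N) →* G, Function.Surjective f ∧
      ∀ w ∈ W, f w = 1 ↔ w ∈ verbalSubgroup (groupVariety G) (FreeGroup (Fin N)) := by
  classical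
  obtain ⟨n, rfl⟩ := Nat.exists_eq_succ_of_ne_zero hN.ne_bot
  obtain ⟨f, hf, h⟩ := exists_surjective_forall_map_ne_one (Nat.lt_succ_iff.mp hN) hV
    (hW.toFinset.filter fun w => w ∉ verbalSubgroup (groupVariety G) (FreeGroup (Fin (n + 1))))
    (by simp)
  refine ⟨f, hf, fun w hw => ⟨fun h1 => ?_, map_eq_one_of_mem_verbalSubgroup f⟩⟩
  by_contra h2
  exact h w (Finset.mem_filter.mpr ⟨hW.mem_toFinset.mpr hw, h2⟩) h1

theorem markedRelativelyFreeGroup_mem_closure {G : Type u} [Group G] [Group.IsNilpotent G]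
    [Group.FG G] {N : ℕ} (hN : Group.rank G < N)
    (hV : groupVariety G = groupVariety (G ⧸ torsionSubgroup G)) :
    markedRelativelyFreeGroup (groupVariety G) N ∈ closure (markedCopies G N) := by
  classical
  rw [closure_induced, mem_closure_iff_nhds]
  intro U hU
  rw [nhds_pi, Filter.mem_pi] at hU
  obtain ⟨I, hI, V, hV', hIU⟩ := hU
  obtain ⟨f, hf, h⟩ := exists_surjective_forall_map_eq_one_iff hN hV hI
  refine ⟨_, hIU ?_, ⟨f.ker, inferInstance⟩, ⟨f, hf, rfl⟩, rfl⟩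
  intro w hw
  have h1 := mem_of_mem_nhds (hV' w)
  convert h1 using 1
  exact decide_eq_decide.mpr (h w hw)

/-! ### Balls in Cayley graphs -/

/-- The bound `2 * R + 1` covers the words expressing that two elements of the ball are joined by an
edge with a given label. -/
theorem cayleyBallsIsomorphic_of_forall {ι : Type*} {G : Type u} {H : Type v} [Group G] [Group H]
    {s : ι → G} {t : ι → H} {R : ℕ}
    (h : ∀ l : List (ι × Bool), l.length ≤ 2 * R + 1 →
      (FreeGroup.lift s (FreeGroup.mk l) = 1 ↔ FreeGroup.lift t (FreeGroup.mk l) = 1)) :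
    CayleyBallsIsomorphic s t R := by
  have key : ∀ (a b : FreeGroup ι) (la lb : List (ι × Bool)), a = FreeGroup.mk la →
      b = FreeGroup.mk lb → la.length + lb.length ≤ 2 * R + 1 →
      (FreeGroup.lift s a = FreeGroup.lift s b ↔ FreeGroup.lift t a = FreeGroup.lift t b) := by
    rintro _ _ la lb rfl rfl hl
    have := h (FreeGroup.invRev la ++ lb) (by
      rw [List.length_append, FreeGroup.invRev_length]
      exact hl)
    rw [← FreeGroup.mul_mk, ← FreeGroup.inv_mk, map_mul, map_mul, map_inv, map_inv,
      inv_mul_eq_one, inv_mul_eq_one] at this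
    exact this
  choose L hL hLs using fun x : cayleyBall s R => x.2
  choose M hM hMt using fun x : cayleyBall t R => x.2
  have mul_of : ∀ (l : List (ι × Bool)) (i : ι),
      FreeGroup.mk l * FreeGroup.of i = FreeGroup.mk (l ++ [(i, true)]) := fun l i => by
    rw [← FreeGroup.mul_mk]
    rfl
  let φ : cayleyBall s R ≃ cayleyBall t R :=
    { toFun := fun x => ⟨FreeGroup.lift t (FreeGroup.mk (L x)), L x, hL x, rfl⟩
      invFun := fun y => ⟨FreeGroup.lift s (FreeGroup.mk (M y)), M y, hM y, rfl⟩
      left_inv := fun x => by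
        apply Subtype.ext
        show FreeGroup.lift s (FreeGroup.mk (M _)) = x
        rw [← hLs x, key _ _ _ _ rfl rfl 
          (by refine (add_le_add (hM _) (hL _)).trans ?_; omega)]
        exact hMt _
      right_inv := fun y => by
        apply Subtype.ext
        show FreeGroup.lift t (FreeGroup.mk (L _)) = y
        rw [← hMt y, ← key _ _ _ _ rfl rfl 
          (by refine (add_le_add (hL _) (hM _)).trans ?_; omega)]
        exact hLs _ }
  refine ⟨φ, fun x => ?_, fun x y i => ?_⟩
  · show (x : G) = 1 ↔ FreeGroup.lift t (FreeGroup.mk (L x)) = 1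
    rw [← hLs x]
    exact h _ ((hL x).trans (by omega))
  · show (y : G) = x * s i ↔
      FreeGroup.lift t (FreeGroup.mk (L y)) = FreeGroup.lift t (FreeGroup.mk (L x)) * t i
    rw [← hLs x, ← hLs y]
    have := key (FreeGroup.mk (L y)) (FreeGroup.mk (L x) * FreeGroup.of i) _ _ rfl (mul_of _ _)
      (by have := hL x; have := hL y; simp; omega)
    simpa using this

theorem CayleyBallsIsomorphic.lift_eq_one_iff {ι : Type*} {G : Type u} {H : Type v} [Group G] [Group H]
    {s : ι → G} {t : ι → H} {R : ℕ} (h : CayleyBallsIsomorphic s t R) {l : List (ι × Bool)}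
    (hl : l.length ≤ R) :
    FreeGroup.lift s (FreeGroup.mk l) = 1 ↔ FreeGroup.lift t (FreeGroup.mk l) = 1 := by
  obtain ⟨φ, h1, hφ⟩ := h
  -- The isomorphism fixes `1` and respects labelled edges, and prefixes of `l` stay in the ball; so
  -- following the path spelled by `l` determines its image.
  have key : ∀ (l : List (ι × Bool)) (hl : l.length ≤ R),
      (φ ⟨FreeGroup.lift s (FreeGroup.mk l), l, hl, rfl⟩ : H) =
        FreeGroup.lift t (FreeGroup.mk l) := by
    intro l
    induction l using List.reverseRecOn with
    | nil =>
      intro hl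
      exact ((h1 _).mp (map_one _)).trans (map_one _).symm
    | append_singleton l a ih =>
      obtain ⟨i, b⟩ := a
      intro hl
      have hl' : l.length ≤ R := by
        rw [List.length_append] at hl
        omega
      have ih := ih hl'
      cases b with
      | true =>
        have := (hφ ⟨_, l, hl', rfl⟩ ⟨_, l ++ [(i, true)], hl, rfl⟩ i).mp (by
          simp [← FreeGroup.mul_mk])
        rw [this, ih]
        simp [← FreeGroup.mul_mk]
      | false =>
        have := (hφ ⟨_, l ++ [(i, false)], hl, rfl⟩ ⟨_, l, hl', rfl⟩ i).mp (by
          simp [← FreeGroup.mul_mk])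
        rw [ih, ← mul_inv_eq_iff_eq_mul] at this
        rw [← this]
        simp [← FreeGroup.mul_mk]
  have := h1 ⟨_, l, hl, rfl⟩
  rw [key l hl] at this
  exact this

/-- Generating tuples satisfying the relations of `H` of bounded length, and no others, give a
sequence as in the definition of `Preforms`. -/
theorem preforms_of_forall_finite {ι : Type} [Finite ι] {G : Type u} {H : Type v} [Group G]
    [Group H] {t : ι → H} (ht : Function.Injective t) (hgen : Subgroup.closure (Set.range t) = ⊤)
    (h : ∀ W : Set (FreeGroup ι), W.Finite → ∃ f : FreeGroup ι →* G, Function.Surjective f ∧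
      ∀ w ∈ W, f w = 1 ↔ FreeGroup.lift t w = 1) : Preforms G H := by
  classical
  have hfin := Set.finite_range t
  let T : Finset H := hfin.toFinset
  have hT : ∀ x, x ∈ T ↔ x ∈ Set.range t := fun x => hfin.mem_toFinset
  let e : ι ≃ T := (Equiv.ofInjective t ht).trans (Equiv.subtypeEquivRight fun x => (hT x).symm)
  have he : ∀ i, ((e i : T) : H) = t i := fun i => rfl
  let ψ : FreeGroup T → FreeGroup ι := FreeGroup.lift fun τ => FreeGroup.of (e.symm τ)
  -- Length `2 * n + 1` suffices for the balls; the extra unit covers the words `τ⁻¹ * σ` already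
  -- for `n = 0`, so that every marking is injective.
  have hfinL : ∀ n, {l : List (T × Bool) | l.length ≤ 2 * n + 2}.Finite := fun n =>
    List.finite_length_le _ _
  choose f hf hfW using fun n => h _ ((hfinL n).image fun l => ψ (FreeGroup.mk l))
  have hlift : ∀ n (w : FreeGroup T), FreeGroup.lift (fun τ => f n (FreeGroup.of (e.symm τ))) w =
      f n (ψ w) := fun n w => (map_lift (f n) _ w).symm
  have hliftt : ∀ w : FreeGroup T, FreeGroup.lift (fun τ : T => (τ : H)) w =
      FreeGroup.lift t (ψ w) := fun w => by
    rw [map_lift]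
    congr 2
    funext τ
    rw [FreeGroup.lift_apply_of, ← he, Equiv.apply_symm_apply]
  have hiff : ∀ n (l : List (T × Bool)), l.length ≤ 2 * n + 2 →
      (FreeGroup.lift (fun τ => f n (FreeGroup.of (e.symm τ))) (FreeGroup.mk l) = 1 ↔
        FreeGroup.lift (fun τ : T => (τ : H)) (FreeGroup.mk l) = 1) := fun n l hl => by
    rw [hlift, hliftt]
    exact hfW n _ ⟨l, hl, rfl⟩
  refine ⟨T, ?_, fun n τ => f n (FreeGroup.of (e.symm τ)), fun n => ⟨fun τ σ hτσ => ?_, ?_⟩,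
    fun R => ?_⟩
  · rw [hfin.coe_toFinset, hgen]
  · have := hiff n (FreeGroup.invRev [(τ, true)] ++ [(σ, true)]) (by simp)
    rw [← FreeGroup.mul_mk, ← FreeGroup.inv_mk, map_mul, map_mul, map_inv, map_inv,
      inv_mul_eq_one, inv_mul_eq_one] at this
    exact Subtype.ext (by simpa using this.mp (by simpa using hτσ))
  · rw [← FreeGroup.lift_surjective_iff_closure_range_eq_top]
    intro x
    obtain ⟨w, rfl⟩ := hf n x
    refine ⟨FreeGroup.lift (fun i => FreeGroup.of (e i)) w, ?_⟩
    rw [lift_comp_lift]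
    simp only [FreeGroup.lift_apply_of, Equiv.symm_apply_apply]
    rw [← map_lift]
    exact congrArg (f n) (DFunLike.congr_fun (FreeGroup.lift_of_eq_id _) w)
  · filter_upwards [eventually_ge_atTop R] with n hn
    exact cayleyBallsIsomorphic_of_forall fun l hl => hiff n l (by omega)

theorem preforms_of_subsingleton (G : Type u) (H : Type v) [Group G] [Group H] [Subsingleton G]
    [Subsingleton H] : Preforms G H :=
  preforms_of_forall_finite (ι := Empty) (t := Empty.elim) (fun i => i.elim)
    (Subsingleton.elim _ _) fun W _ => ⟨1, fun x => ⟨1, Subsingleton.elim _ _⟩, fun w _ => by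
      simp [Subsingleton.elim (FreeGroup.lift _ w) (1 : H)]⟩

theorem preforms_of_ker_eq_verbalSubgroup {G : Type u} [Group G] [Group.IsNilpotent G]
    [Group.FG G] {N : ℕ} (hN : Group.rank G < N)
    (hV : groupVariety G = groupVariety (G ⧸ torsionSubgroup G)) {H : Type v} [Group H]
    (q : FreeGroup (Fin N) →* H) (hq : Function.Surjective q)
    (hker : q.ker = verbalSubgroup (groupVariety G) (FreeGroup (Fin N))) : Preforms G H := by
  have hqt : FreeGroup.lift (fun i => q (FreeGroup.of i)) = q :=
    FreeGroup.ext_hom _ _ fun i => by simp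
  -- If `G` is trivial, the images of the free generators coincide and need not form an injective
  -- family.
  rcases subsingleton_or_nontrivial G with hG | hG
  · have : Subsingleton H := by
      refine ⟨fun a b => ?_⟩
      suffices h : ∀ a : H, a = 1 by rw [h a, h b]
      intro a
      obtain ⟨w, rfl⟩ := hq a
      show w ∈ q.ker
      rw [hker]
      exact mem_verbalSubgroup_of_forall_lift_eq_one fun g => Subsingleton.elim _ _
    exact preforms_of_subsingleton G H
  · refine preforms_of_forall_finite (t := fun i => q (FreeGroup.of i)) (fun i j hij => ?_) ?_
      fun W hW => ?_
    · by_contra hne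
      obtain ⟨g, hg⟩ := exists_ne (1 : G)
      have h1 : (FreeGroup.of i)⁻¹ * FreeGroup.of j ∈ q.ker := by
        show q _ = 1
        rw [map_mul, map_inv, inv_mul_eq_one]
        exact hij
      rw [hker] at h1
      -- The assignment of `g` to the letter `i` and `1` to all others separates the letters `i` and
      -- `j`.
      have := map_eq_one_of_mem_verbalSubgroup (FreeGroup.lift (Pi.mulSingle i g)) h1
      simp [Pi.mulSingle_eq_of_ne (Ne.symm hne)] at this
      exact hg this
    · rw [← FreeGroup.lift_surjective_iff_closure_range_eq_top, hqt]
      exact hq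
    · rw [hqt]
      obtain ⟨f, hf, h⟩ := exists_surjective_forall_map_eq_one_iff hN hV hW
      refine ⟨f, hf, fun w hw => ?_⟩
      rw [h w hw, ← hker]
      rfl

/-! ### Finitely generated nilpotent groups -/

/-- The left-normed commutators of weight `n + 1` in the elements of `S`. -/
def leftNormedCommutators {X : Type u} [Group X] (S : Set X) : ℕ → Set X
  | 0 => S
  | n + 1 => Set.image2 (fun a s => ⁅a, s⁆) (leftNormedCommutators S n) S

theorem finite_leftNormedCommutators {X : Type*} [Group X] {S : Set X} (hS : S.Finite) (n : ℕ) :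
    (leftNormedCommutators S n).Finite := by
  induction n with
  | zero => exact hS
  | succ n ih => exact ih.image2 _ hS

/-- Modulo the commutators of the next weight, the left-normed ones of the present weight commute
with all generators, hence are central; so is their normal closure. -/
theorem lowerCentralSeries_eq_normalClosure {X : Type*} [Group X] {S : Set X}
    (hS : Subgroup.closure S = ⊤) (n : ℕ) :
    (⊤ : Subgroup X).lowerCentralSeries n =
      Subgroup.normalClosure (leftNormedCommutators S n) := by
  apply le_antisymm
  · induction n with
    | zero =>
      show ⊤ ≤ _
      rw [← hS]
      exact Subgroup.closure_le_normalClosure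
    | succ n ih =>
      show ⁅(⊤ : Subgroup X).lowerCentralSeries n, (⊤ : Subgroup X)⁆ ≤ _
      set N := Subgroup.normalClosure (leftNormedCommutators S (n + 1)) with hN
      have hle : Subgroup.normalClosure (leftNormedCommutators S n) ≤
          (Subgroup.center (X ⧸ N)).comap (QuotientGroup.mk' N) := by
        refine Subgroup.normalClosure_le_normal fun a ha => ?_
        show (a : X ⧸ N) ∈ Subgroup.center (X ⧸ N)
        have h1 : Subgroup.closure S ≤
            (Subgroup.centralizer {(a : X ⧸ N)}).comap (QuotientGroup.mk' N) := by
          rw [Subgroup.closure_le]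
          intro s hs
          show (s : X ⧸ N) ∈ Subgroup.centralizer {(a : X ⧸ N)}
          rw [Subgroup.mem_centralizer_singleton_iff]
          refine (commutatorElement_eq_one_iff_mul_comm.mp ?_).symm
          exact (QuotientGroup.eq_one_iff ⁅a, s⁆).mpr
            (Subgroup.subset_normalClosure ⟨a, ha, s, hs, rfl⟩)
        rw [hS] at h1
        rw [Subgroup.mem_center_iff]
        intro y
        induction y using QuotientGroup.induction_on with
        | H y => exact Subgroup.mem_centralizer_singleton_iff.mp (h1 (Subgroup.mem_top y))
      rw [Subgroup.commutator_le]
      intro a ha y _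
      rw [← QuotientGroup.eq_one_iff]
      exact commutatorElement_eq_one_iff_mul_comm.mpr
        (Subgroup.mem_center_iff.mp (hle (ih ha)) (y : X ⧸ N)).symm
  · refine Subgroup.normalClosure_le_normal ?_
    induction n with
    | zero => exact fun _ _ => Subgroup.mem_top _
    | succ n ih =>
      rintro _ ⟨a, ha, s, -, rfl⟩
      exact Subgroup.commutator_mem_commutator (ih ha) (Subgroup.mem_top s)

theorem exists_finite_le_closure_sup_ker {X Y : Type*} [Group X] [Group Y] {f : X →* Y}
    {H : Subgroup X} (h : (H.map f).FG) :
    ∃ T : Set X, T.Finite ∧ T ⊆ H ∧ H ≤ Subgroup.closure T ⊔ (H ⊓ f.ker) := by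
  obtain ⟨T, hT, hTfin⟩ := (Subgroup.fg_iff _).mp h
  have hTH : T ⊆ f '' H := by
    rw [← Subgroup.coe_map, ← hT]
    exact Subgroup.subset_closure
  obtain ⟨T', hT'H, hT'fin, hT⟩ := (Set.exists_subset_image_finite_and
    (p := fun T => Subgroup.closure T = H.map f)).mp ⟨T, hTH, hTfin, hT⟩
  refine ⟨T', hT'fin, hT'H, fun x hx => ?_⟩
  rw [← MonoidHom.map_closure] at hT
  obtain ⟨y, hy, hyx⟩ : f x ∈ (Subgroup.closure T').map f := by
    rw [hT]
    exact ⟨x, hx, rfl⟩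
  have hyH : y ∈ H := (Subgroup.closure_le H).mpr hT'H hy
  have : x = y * (y⁻¹ * x) := by group
  rw [this]
  refine Subgroup.mul_mem_sup hy (Subgroup.mem_inf.mpr ⟨mul_mem (inv_mem hyH) hx, ?_⟩)
  show f _ = 1
  rw [map_mul, map_inv, hyx, inv_mul_cancel]

theorem fg_of_fg_map_of_fg_inf_ker {X Y : Type*} [Group X] [Group Y] {f : X →* Y} {H : Subgroup X}
    (h : (H.map f).FG) (h' : (H ⊓ f.ker).FG) : H.FG := by
  obtain ⟨T, hT, hTH, hle⟩ := exists_finite_le_closure_sup_ker h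
  have : H = Subgroup.closure T ⊔ (H ⊓ f.ker) :=
    le_antisymm hle (sup_le ((Subgroup.closure_le H).mpr hTH) inf_le_left)
  rw [this]
  exact ((Subgroup.fg_iff _).mpr ⟨T, rfl, hT⟩).sup h'

theorem subgroup_fg_of_commGroup {A : Type*} [CommGroup A] [Group.FG A] (B : Subgroup A) :
    B.FG := by
  have : Module.Finite ℤ (Additive A) := Module.Finite.iff_addGroup_fg.mpr inferInstance
  rw [Subgroup.fg_iff_add_fg, ← AddSubgroup.toIntSubmodule_toAddSubgroup (Subgroup.toAddSubgroup B),
    ← Submodule.fg_iff_addSubgroup_fg]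
  exact IsNoetherian.noetherian _

open scoped IsMulCommutative in
theorem subgroup_fg_of_le_center {X : Type*} [Group X] {K : Subgroup X} (hK : K ≤ Subgroup.center X)
    (hfg : K.FG) {B : Subgroup X} (hB : B ≤ K) : B.FG := by
  have : IsMulCommutative K := ⟨⟨fun a b =>
    Subtype.ext (Subgroup.mem_center_iff.mp (hK b.2) a)⟩⟩
  have : Group.FG K := (Group.fg_iff_subgroup_fg K).mpr hfg
  obtain ⟨T, hT, hfin⟩ := (Subgroup.fg_iff _).mp (subgroup_fg_of_commGroup (B.subgroupOf K))
  refine (Subgroup.fg_iff B).mpr ⟨K.subtype '' T, ?_, hfin.image _⟩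
  rw [← MonoidHom.map_closure, hT, Subgroup.subgroupOf_map_subtype, inf_eq_left.mpr hB]

/-- Finitely generated nilpotent groups satisfy the maximal condition on subgroups. -/
theorem subgroup_fg_of_isNilpotent {X : Type u} [Group X] [Group.IsNilpotent X] [Group.FG X]
    (H : Subgroup X) : H.FG := by
  obtain ⟨c, hc⟩ := (Subgroup.nilpotent_iff_lowerCentralSeries (G := X)).mp inferInstance
  suffices key : ∀ (c : ℕ) (X : Type u) [Group X] [Group.FG X],
      (⊤ : Subgroup X).lowerCentralSeries c = ⊥ → ∀ H : Subgroup X, H.FG from key c X hc H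
  clear hc c H
  intro c
  induction c with
  | zero =>
    intro X _ _ h H
    have : (⊤ : Subgroup X) = ⊥ := h
    rw [show H = ⊥ from le_bot_iff.mp (this ▸ le_top)]
    exact Subgroup.FG.bot
  | succ c ih =>
    intro X _ _ h H
    set K := (⊤ : Subgroup X).lowerCentralSeries c with hK
    have hcenter : K ≤ Subgroup.center X :=
      Subgroup.commutator_top_right_eq_bot_iff_le_center.mp h
    obtain ⟨S, hS, hSfin⟩ := (Group.fg_iff (G := X)).mp inferInstance
    -- The last nontrivial term is central, so normal generators are fixed by conjugation and
    -- generate it as a subgroup.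
    have hKfg : K.FG := by
      rw [hK, lowerCentralSeries_eq_normalClosure hS, Subgroup.normalClosure]
      refine (Subgroup.fg_iff _).mpr ⟨_, rfl, (finite_leftNormedCommutators hSfin c).subset ?_⟩
      intro x hx
      obtain ⟨a, ha, hax⟩ := Group.mem_conjugatesOfSet_iff.mp hx
      have haK : a ∈ K := by
        rw [hK, lowerCentralSeries_eq_normalClosure hS]
        exact Subgroup.subset_normalClosure ha
      obtain ⟨g, rfl⟩ := isConj_iff.mp hax
      rw [Subgroup.mem_center_iff.mp (hcenter haK) g, mul_inv_cancel_right]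
      exact ha
    refine fg_of_fg_map_of_fg_inf_ker (f := QuotientGroup.mk' K) (ih _ ?_ _) ?_
    · rw [← Subgroup.map_top_of_surjective _ (QuotientGroup.mk'_surjective K),
        ← Subgroup.map_lowerCentralSeries, Subgroup.map_eq_bot_iff, QuotientGroup.ker_mk']
    · exact subgroup_fg_of_le_center hcenter hKfg
        (inf_le_right.trans (QuotientGroup.ker_mk' K).le)

/-- Finitely generated nilpotent groups are finitely presented. -/
theorem exists_finite_relations {ι : Type u} [Finite ι] {D : Type v} [Group D]
    [Group.IsNilpotent D] (q : FreeGroup ι →* D) :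
    ∃ R : Set (FreeGroup ι), R.Finite ∧ R ⊆ q.ker ∧
      ∀ N : Subgroup (FreeGroup ι), N.Normal → R ⊆ N → q.ker ≤ N := by
  obtain ⟨c, hc⟩ := (Subgroup.nilpotent_iff_lowerCentralSeries (G := D)).mp inferInstance
  -- The finite set `R₁` imposes nilpotency. Modulo `R₁` the free group satisfies the maximal
  -- condition, so finitely many further relations `R₂` generate the rest of the kernel.
  set R₁ := leftNormedCommutators (Set.range (FreeGroup.of (α := ι))) c with hR₁
  have hγ := lowerCentralSeries_eq_normalClosure (FreeGroup.closure_range_of ι) c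
  set M := Subgroup.normalClosure R₁ with hM
  have hMq : M ≤ q.ker := by
    rw [← hγ, ← Subgroup.map_eq_bot_iff, Subgroup.map_lowerCentralSeries, eq_bot_iff, ← hc]
    exact Subgroup.lowerCentralSeries_mono c le_top
  have : Group.IsNilpotent (FreeGroup ι ⧸ M) := by
    refine Subgroup.nilpotent_iff_lowerCentralSeries.mpr ⟨c, ?_⟩
    rw [← Subgroup.map_top_of_surjective _ (QuotientGroup.mk'_surjective M),
      ← Subgroup.map_lowerCentralSeries, Subgroup.map_eq_bot_iff, QuotientGroup.ker_mk', hγ]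
  obtain ⟨R₂, hR₂, hR₂q, hle⟩ := exists_finite_le_closure_sup_ker
    (subgroup_fg_of_isNilpotent (q.ker.map (QuotientGroup.mk' M)))
  refine ⟨R₁ ∪ R₂, (finite_leftNormedCommutators (Set.finite_range _) c).union hR₂,
    Set.union_subset (Subgroup.subset_normalClosure.trans hMq) hR₂q, fun N hN hRN => ?_⟩
  refine hle.trans (sup_le ((Subgroup.closure_le N).mpr (Set.subset_union_right.trans hRN)) ?_)
  refine inf_le_right.trans ((QuotientGroup.ker_mk' M).le.trans ?_)
  exact Subgroup.normalClosure_le_normal (Set.subset_union_left.trans hRN)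

/-! ### Consequences of preforming -/

theorem Preforms.exists_hom_of_finite {C : Type u} {D : Type v} [Group C] [Group D]
    (h : Preforms C D) : ∃ (T : Finset D) (q : FreeGroup T →* D), Function.Surjective q ∧
      ∀ W : Set (FreeGroup T), W.Finite → ∃ f : FreeGroup T →* C, Function.Surjective f ∧
        ∀ w ∈ W, f w = 1 ↔ q w = 1 := by
  obtain ⟨T, hT, S, hS, hball⟩ := h
  refine ⟨T, FreeGroup.lift (fun t : T => (t : D)), ?_, fun W hW => ?_⟩
  · rw [FreeGroup.lift_surjective_iff_closure_range_eq_top, Subtype.range_coe_subtype]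
    exact hT
  · classical
    let R := hW.toFinset.sup fun w => w.toWord.length
    obtain ⟨n, hn⟩ := (hball R).exists
    refine ⟨FreeGroup.lift (S n),
      FreeGroup.lift_surjective_iff_closure_range_eq_top.mpr (hS n).2, fun w hw => ?_⟩
    have hwR : w.toWord.length ≤ R :=
      Finset.le_sup (f := fun w : FreeGroup T => w.toWord.length) (hW.mem_toFinset.mpr hw)
    have := hn.lift_eq_one_iff hwR
    rwa [FreeGroup.mk_toWord] at this

/-- `D` is finitely presented, and its finitely many relations hold in all sufficiently close
markings of `C`. -/
theorem Preforms.exists_surjective {C : Type u} {D : Type v} [Group C] [Group D]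
    [Group.IsNilpotent D] (h : Preforms C D) : ∃ f : D →* C, Function.Surjective f := by
  obtain ⟨T, q, hq, h⟩ := h.exists_hom_of_finite
  obtain ⟨R, hR, hRq, hRN⟩ := exists_finite_relations q
  obtain ⟨f, hf, hfR⟩ := h R hR
  have hker : q.ker ≤ f.ker := hRN f.ker inferInstance fun r hr => (hfR r hr).mpr (hRq hr)
  refine ⟨q.liftOfSurjective hq ⟨f, hker⟩, fun x => ?_⟩
  obtain ⟨w, rfl⟩ := hf x
  exact ⟨q w, q.liftOfRightInverse_comp_apply _ _ ⟨f, hker⟩ w⟩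

/-- One value of an identity in `D` involves a single word in the generators, which a close marking
of `C` tests. -/
theorem Preforms.groupVariety_subset {C : Type u} {D : Type v} [Group C] [Group D]
    (h : Preforms C D) : groupVariety C ⊆ groupVariety D := by
  obtain ⟨T, q, hq, h⟩ := h.exists_hom_of_finite
  intro w hw d
  choose e he using fun i => hq (d i)
  obtain ⟨f, -, hf⟩ := h {FreeGroup.lift e w} (Set.finite_singleton _)
  have := (hf _ rfl).mp (by
    rw [map_lift]
    exact hw _)
  rw [map_lift] at this
  simpa only [he] using this

theorem groupVariety_subset_of_surjective {A B : Type*} [Group A] [Group B] {f : A →* B}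
    (hf : Function.Surjective f) : groupVariety A ⊆ groupVariety B := by
  intro w hw b
  choose a ha using fun i => hf (b i)
  have := congrArg f (hw a)
  rw [map_lift, map_one] at this
  simpa only [ha] using this

theorem groupVariety_subset_quotient {A : Type*} [Group A] (N : Subgroup A) [N.Normal] :
    groupVariety A ⊆ groupVariety (A ⧸ N) :=
  groupVariety_subset_of_surjective (QuotientGroup.mk'_surjective N)

/-- Nilpotency is expressed by identities: the `c`-th term of the lower central series of the free
group consists of identities of `A`, hence of `B`. -/
theorem isNilpotent_of_groupVariety_subset {A B : Type*} [Group A] [Group B]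
    [Group.IsNilpotent A] [Group.FG B] (h : groupVariety A ⊆ groupVariety B) :
    Group.IsNilpotent B := by
  obtain ⟨c, hc⟩ := (Subgroup.nilpotent_iff_lowerCentralSeries (G := A)).mp inferInstance
  refine Subgroup.nilpotent_iff_lowerCentralSeries.mpr ⟨c, ?_⟩
  obtain ⟨t, ht⟩ := exists_fin_generating (le_refl (Group.rank B))
  let b : ℕ → B := fun i => if h : i < Group.rank B then t ⟨i, h⟩ else 1
  have hb : Function.Surjective (FreeGroup.lift b) := by
    rw [FreeGroup.lift_surjective_iff_closure_range_eq_top, eq_top_iff, ← ht]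
    refine Subgroup.closure_mono ?_
    rintro _ ⟨i, rfl⟩
    exact ⟨i, by simp [b]⟩
  rw [← Subgroup.map_top_of_surjective _ hb, ← Subgroup.map_lowerCentralSeries,
    Subgroup.map_eq_bot_iff]
  intro w hw
  refine h (fun a => ?_) b
  have := Subgroup.mem_map_of_mem (FreeGroup.lift a) hw
  rw [Subgroup.map_lowerCentralSeries] at this
  exact hc.le (Subgroup.lowerCentralSeries_mono c le_top this)

/-- If `w` is an identity of the torsion-free quotient of a finitely generated nilpotent group,
then a power of `w` is an identity of the group. -/
theorem exists_pow_mem_groupVariety {C : Type*} [Group C] [Group.IsNilpotent C] [Group.FG C]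
    {w : FreeGroup ℕ} (hw : w ∈ groupVariety (C ⧸ torsionSubgroup C)) :
    ∃ e : ℕ, 0 < e ∧ w ^ e ∈ groupVariety C := by
  have hfg := (Group.fg_iff_subgroup_fg _).mpr (subgroup_fg_of_isNilpotent (torsionSubgroup C))
  obtain ⟨S, hS, hSfin⟩ := Group.fg_iff.mp hfg
  obtain ⟨e, he, h⟩ := exists_pow_eq_one_of_finite hS hSfin fun s _ => by
    rw [← Submonoid.isOfFinOrder_coe (H := (torsionSubgroup C).toSubmonoid)]
    exact isOfFinOrder_of_mem_torsionSubgroup s.2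
  refine ⟨e, he, fun g => ?_⟩
  have hg : FreeGroup.lift g w ∈ torsionSubgroup C := by
    rw [← QuotientGroup.eq_one_iff, ← hw fun i => QuotientGroup.mk (g i)]
    exact map_lift (QuotientGroup.mk' (torsionSubgroup C)) g w
  rw [map_pow]
  exact congrArg Subtype.val (h ⟨_, hg⟩)

/-! ### Nilpotent groups that generate a given variety -/

/-- `V` contains the roots of its elements. -/
def IsRootClosed (V : Set (FreeGroup ℕ)) : Prop :=
  ∀ (w : FreeGroup ℕ) (e : ℕ), 0 < e → w ^ e ∈ V → w ∈ V

theorem isRootClosed_groupVariety {X : Type*} [Group X]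
    (hX : ∀ (x : X) (n : ℕ), 0 < n → x ^ n = 1 → x = 1) : IsRootClosed (groupVariety X) :=
  fun w e he h g => hX _ e he (by rw [← map_pow]; exact h g)

/-- Root closure depends on the variety alone; this carries the hypothesis on `G` over to every
finitely generated nilpotent group with the same variety. -/
theorem IsRootClosed.groupVariety_eq {C : Type*} [Group C] [Group.IsNilpotent C] [Group.FG C]
    (h : IsRootClosed (groupVariety C)) :
    groupVariety C = groupVariety (C ⧸ torsionSubgroup C) := by
  refine (groupVariety_subset_quotient _).antisymm fun w hw => ?_
  obtain ⟨e, he, hwe⟩ := exists_pow_mem_groupVariety hw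
  exact h w e he hwe

/-- `A` is a nilpotent group whose identities are the words in `V`. -/
def IsNilpotentGenerator (V : Set (FreeGroup ℕ)) (A : Type u) [Group A] : Prop :=
  Group.IsNilpotent A ∧ groupVariety A = V

namespace IsNilpotentGenerator

variable {V : Set (FreeGroup ℕ)} {A : Type u} {B : Type v} [Group A] [Group B]

theorem of_mulEquiv (h : IsNilpotentGenerator V A) (e : A ≃* B) : IsNilpotentGenerator V B := by
  have := h.1
  refine ⟨Group.nilpotent_of_mulEquiv e, ?_⟩
  rw [← h.2]
  exact (groupVariety_subset_of_surjective (f := e.symm.toMonoidHom) e.symm.surjective).antisymm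
    (groupVariety_subset_of_surjective (f := e.toMonoidHom) e.surjective)

theorem of_preforms (h : IsNilpotentGenerator V A) [Group.FG B] (hAB : Preforms A B) :
    IsNilpotentGenerator V B := by
  have := h.1
  have hB : Group.IsNilpotent B := isNilpotent_of_groupVariety_subset hAB.groupVariety_subset
  obtain ⟨f, hf⟩ := hAB.exists_surjective
  refine ⟨hB, ?_⟩
  rw [← h.2]
  exact (groupVariety_subset_of_surjective hf).antisymm hAB.groupVariety_subset

theorem of_preformed (h : IsNilpotentGenerator V A) (hBA : Preforms B A) :
    IsNilpotentGenerator V B := by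
  have := h.1
  obtain ⟨f, hf⟩ := hBA.exists_surjective
  refine ⟨Group.nilpotent_of_surjective f hf, ?_⟩
  rw [← h.2]
  exact hBA.groupVariety_subset.antisymm (groupVariety_subset_of_surjective hf)

/-- The product with a finite cyclic group. -/
theorem prod_zmod (hA : IsNilpotentGenerator V A)
    (htf : ∀ (x : A) (n : ℕ), 0 < n → x ^ n = 1 → x = 1) [Nontrivial A] (m : ℕ) :
    IsNilpotentGenerator V (A × Multiplicative (ZMod m)) := by
  have := hA.1
  refine ⟨inferInstance, ?_⟩
  rw [← hA.2]
  refine (groupVariety_subset_of_surjective (f := MonoidHom.fst A (Multiplicative (ZMod m)))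
    Prod.fst_surjective).antisymm fun w hw => ?_
  -- A nontrivial element of `A` generates an infinite cyclic group, so identities of `A` hold in
  -- `ℤ` and in its quotients.
  have hz : w ∈ groupVariety (Multiplicative (ZMod m)) := by
    obtain ⟨x, hx⟩ := exists_ne (1 : A)
    have hinj : Function.Injective (zpowersHom A x) := by
      rw [injective_iff_map_eq_one]
      intro n hn
      rw [zpowersHom_apply] at hn
      have h0 : n.toAdd = 0 := by
        by_contra hne
        refine hx (htf x n.toAdd.natAbs (Int.natAbs_pos.mpr hne) ?_)
        rw [← zpow_natCast]
        rcases Int.natAbs_eq n.toAdd with h' | h'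
        · rw [← h', hn]
        · rw [← inv_eq_one, ← zpow_neg, ← h', hn]
      exact h0
    have hZ : w ∈ groupVariety (Multiplicative ℤ) := fun g => by
      apply hinj
      rw [map_lift, map_one]
      exact hw _
    exact groupVariety_subset_of_surjective
      (f := AddMonoidHom.toMultiplicative (Int.castAddHom (ZMod m))) (fun y => by
        obtain ⟨n, hn⟩ := ZMod.intCast_surjective y.toAdd
        exact ⟨Multiplicative.ofAdd n, congrArg Multiplicative.ofAdd hn⟩) hZ
  intro g
  refine Prod.ext ?_ ?_
  · have := map_lift (MonoidHom.fst A (Multiplicative (ZMod m))) g w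
    exact this.trans (hw _)
  · have := map_lift (MonoidHom.snd A (Multiplicative (ZMod m))) g w
    exact this.trans (hz _)

end IsNilpotentGenerator

/-! ### Elements of prime order -/

/-- `A` contains a nontrivial element that is killed by `p`. -/
def HasPTorsion (p : ℕ) (A : Type u) [Group A] : Prop :=
  ∃ a : A, a ^ p = 1 ∧ a ≠ 1

theorem HasPTorsion.of_mulEquiv {p : ℕ} {A : Type u} {B : Type v} [Group A] [Group B]
    (h : HasPTorsion p A) (e : A ≃* B) : HasPTorsion p B := by
  obtain ⟨a, ha, ha1⟩ := h
  exact ⟨e a, by rw [← map_pow, ha, map_one], fun h => ha1 (e.map_eq_one_iff.mp h)⟩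

/-- The two conditions on a preimage `w` of the element, `w ^ p` trivial and `w` nontrivial, are
visible in a close marking. -/
theorem HasPTorsion.of_preforms {p : ℕ} {C : Type u} {D : Type v} [Group C] [Group D]
    (h : HasPTorsion p D) (hCD : Preforms C D) : HasPTorsion p C := by
  obtain ⟨d, hd, hd1⟩ := h
  obtain ⟨T, q, hq, h⟩ := hCD.exists_hom_of_finite
  obtain ⟨w, rfl⟩ := hq d
  obtain ⟨f, -, hf⟩ := h {w, w ^ p} (Set.toFinite _)
  refine ⟨f w, ?_, fun h1 => hd1 ((hf w (Or.inl rfl)).mp h1)⟩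
  rw [← map_pow]
  exact (hf (w ^ p) (Or.inr rfl)).mpr (by rw [map_pow, hd])

theorem hasPTorsion_prod_zmod (A : Type*) [Group A] {p : ℕ} (hp : 1 < p) :
    HasPTorsion p (A × Multiplicative (ZMod p)) := by
  have : Fact (1 < p) := ⟨hp⟩
  refine ⟨(1, Multiplicative.ofAdd 1), Prod.ext (one_pow p) ?_, fun h => ?_⟩
  · show Multiplicative.ofAdd (1 : ZMod p) ^ p = 1
    rw [← ofAdd_nsmul]
    simp
  · have h1 : Multiplicative.ofAdd (1 : ZMod p) = 1 := congrArg Prod.snd h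
    exact one_ne_zero (Multiplicative.ofAdd.injective h1)

theorem not_hasPTorsion_prod_zmod {A : Type*} [Group A]
    (htf : ∀ (x : A) (n : ℕ), 0 < n → x ^ n = 1 → x = 1) {p m : ℕ} (hp : 0 < p)
    (hpm : p.Coprime m) : ¬ HasPTorsion p (A × Multiplicative (ZMod m)) := by
  rintro ⟨⟨x, z⟩, h, h1⟩
  have hx : x = 1 := htf x p hp (congrArg Prod.fst h)
  have hz : z ^ p = 1 := congrArg Prod.snd h
  have hzm : z ^ m = 1 := by
    apply Multiplicative.toAdd.injective
    rw [toAdd_pow]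
    simp
  have hz1 : z = 1 := by
    have := pow_gcd_eq_one.mpr ⟨hz, hzm⟩
    rwa [Nat.Coprime.gcd_eq_one hpm, pow_one] at this
  exact h1 (Prod.ext hx hz1)

/-! ### The component of a nilpotent group in the preform graph -/

namespace FGGroupClass

theorem exists_eq_mk (a : FGGroupClass.{u}) :
    ∃ (A : Type u) (_ : Group A) (_ : Group.FG A), a = mk A := by
  induction a using Quotient.inductionOn with
  | h A => exact ⟨A.1, inferInstance, A.2, rfl⟩

theorem nonempty_mulEquiv_of_mk_eq {A B : Type u} [Group A] [Group B] [Group.FG A] [Group.FG B]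
    (h : mk A = mk B) : Nonempty (A ≃* B) := Quotient.exact h

theorem preformGraph_adj_or_eq {A B : Type u} [Group A] [Group B] [Group.FG A] [Group.FG B]
    (h : _root_.Preforms A B) : preformGraph.Adj (mk A) (mk B) ∨ mk A = mk B := by
  by_cases hne : mk A = mk B
  · exact Or.inr hne
  · exact Or.inl ⟨hne, Or.inl ⟨A, B, _, _, _, _, rfl, rfl, h⟩⟩

theorem isNilpotentGenerator_of_adj {V : Set (FreeGroup ℕ)} {A B : Type u} [Group A] [Group B]
    [Group.FG A] [Group.FG B] (hA : IsNilpotentGenerator V A)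
    (h : preformGraph.Adj (mk A) (mk B)) : IsNilpotentGenerator V B := by
  rcases h.2 with ⟨A', B', _, _, _, _, hA', hB', hp⟩ | ⟨B', A', _, _, _, _, hB', hA', hp⟩
  · obtain ⟨eA⟩ := nonempty_mulEquiv_of_mk_eq hA'
    obtain ⟨eB⟩ := nonempty_mulEquiv_of_mk_eq hB'
    exact ((hA.of_mulEquiv eA).of_preforms hp).of_mulEquiv eB.symm
  · obtain ⟨eA⟩ := nonempty_mulEquiv_of_mk_eq hA'
    obtain ⟨eB⟩ := nonempty_mulEquiv_of_mk_eq hB'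
    exact ((hA.of_mulEquiv eA).of_preformed hp).of_mulEquiv eB.symm

theorem isNilpotentGenerator_of_reachable {V : Set (FreeGroup ℕ)} {A B : Type u} [Group A]
    [Group B] [Group.FG A] [Group.FG B] (hA : IsNilpotentGenerator V A)
    (h : preformGraph.Reachable (mk A) (mk B)) : IsNilpotentGenerator V B := by
  suffices key : ∀ {a b : FGGroupClass.{u}}, preformGraph.Walk a b →
      (∀ (A : Type u) [Group A] [Group.FG A], a = mk A → IsNilpotentGenerator V A) →
      ∀ (B : Type u) [Group B] [Group.FG B], b = mk B → IsNilpotentGenerator V B by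
    obtain ⟨p⟩ := h
    refine key p (fun A' _ _ hA' => ?_) B rfl
    obtain ⟨e⟩ := nonempty_mulEquiv_of_mk_eq hA'
    exact hA.of_mulEquiv e
  intro a b p
  induction p with
  | nil => exact fun h => h
  | @cons a c b hac _ ih =>
    intro h
    refine ih fun C _ _ hC => ?_
    obtain ⟨A, _, _, rfl⟩ := exists_eq_mk a
    rw [hC] at hac
    exact isNilpotentGenerator_of_adj (h A rfl) hac

theorem not_adj_prod_zmod {X : Type u} [Group X] [Group.FG X]
    (htf : ∀ (x : X) (n : ℕ), 0 < n → x ^ n = 1 → x = 1) :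
    ¬ (preformGraph.Adj (mk (X × Multiplicative (ZMod 2))) (mk (X × Multiplicative (ZMod 3))) ∨
      mk (X × Multiplicative (ZMod 2)) = mk (X × Multiplicative (ZMod 3))) := by
  have h2 := hasPTorsion_prod_zmod X (p := 2) (by norm_num)
  have h3 := hasPTorsion_prod_zmod X (p := 3) (by norm_num)
  have h23 := not_hasPTorsion_prod_zmod htf (p := 2) (m := 3) two_pos (by norm_num)
  have h32 := not_hasPTorsion_prod_zmod htf (p := 3) (m := 2) three_pos (by norm_num)
  rintro (h | h)
  · rcases h.2 with ⟨A, B, _, _, _, _, hA, hB, hp⟩ | ⟨B, A, _, _, _, _, hB, hA, hp⟩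
    · obtain ⟨eA⟩ := nonempty_mulEquiv_of_mk_eq hA
      obtain ⟨eB⟩ := nonempty_mulEquiv_of_mk_eq hB
      exact h32 (((h3.of_mulEquiv eB).of_preforms hp).of_mulEquiv eA.symm)
    · obtain ⟨eA⟩ := nonempty_mulEquiv_of_mk_eq hA
      obtain ⟨eB⟩ := nonempty_mulEquiv_of_mk_eq hB
      exact h23 (((h2.of_mulEquiv eA).of_preforms hp).of_mulEquiv eB.symm)
  · obtain ⟨e⟩ := nonempty_mulEquiv_of_mk_eq h
    exact h23 (h2.of_mulEquiv e)

end FGGroupClass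

/-- A nilpotent group preforms the relatively free groups of large rank in its variety, in any
universe. -/
theorem IsNilpotentGenerator.preforms_ulift {V : Set (FreeGroup ℕ)} (hV : IsRootClosed V)
    {A : Type u} [Group A] [Group.FG A] (hA : IsNilpotentGenerator V A) {N : ℕ}
    (hN : Group.rank A < N) : Preforms A (ULift.{u} (RelativelyFreeGroup V N)) := by
  obtain ⟨hnil, rfl⟩ := hA
  refine preforms_of_ker_eq_verbalSubgroup hN hV.groupVariety_eq
    (MulEquiv.ulift.symm.toMonoidHom.comp (QuotientGroup.mk' _))
    (MulEquiv.ulift.symm.surjective.comp (QuotientGroup.mk'_surjective _)) ?_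
  ext w
  exact ⟨fun h => (QuotientGroup.eq_one_iff w).mp (congrArg ULift.down h),
    fun h => congrArg ULift.up ((QuotientGroup.eq_one_iff w).mpr h)⟩

theorem ediam_preformComponent {G : Type u} [Group G] [Group.IsNilpotent G] [Group.FG G]
    [Nontrivial G] (hV : groupVariety G = groupVariety (G ⧸ torsionSubgroup G)) :
    (preformComponent G).toSimpleGraph.ediam = 2 := by
  set V := groupVariety G
  let X := G ⧸ torsionSubgroup G
  have htf : ∀ (x : X) (n : ℕ), 0 < n → x ^ n = 1 → x = 1 :=
    fun x n hn h => eq_one_of_pow_eq_one_quotient_torsionSubgroup hn h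
  have hroot : IsRootClosed V := by
    rw [hV]
    exact isRootClosed_groupVariety htf
  have hG : IsNilpotentGenerator V G := ⟨inferInstance, rfl⟩
  have hXgen : IsNilpotentGenerator V X := ⟨inferInstance, hV.symm⟩
  have hXnt : Nontrivial X := by
    by_contra hX
    rw [not_nontrivial_iff_subsingleton] at hX
    obtain ⟨g, hg⟩ := exists_ne (1 : G)
    have h0 : FreeGroup.of 0 ∈ V := by
      rw [hV]
      exact fun _ => Subsingleton.elim _ _
    exact hg (by simpa using h0 fun _ => g)
  have hFG : ∀ N, Group.FG (ULift.{u} (RelativelyFreeGroup V N)) := fun N =>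
    Group.fg_of_surjective (f := (MulEquiv.ulift.symm : RelativelyFreeGroup V N ≃*
      ULift.{u} (RelativelyFreeGroup V N)).toMonoidHom) MulEquiv.ulift.symm.surjective
  let C := preformComponent G
  -- The component consists of all finitely generated nilpotent groups with variety `V`, since any
  -- two of them preform a common relatively free group.
  have hmem : ∀ (A : Type u) [Group A] [Group.FG A],
      FGGroupClass.mk A ∈ C.supp ↔ IsNilpotentGenerator V A := by
    intro A _ _
    rw [SimpleGraph.ConnectedComponent.mem_supp_iff]
    change preformGraph.connectedComponentMk _ = preformGraph.connectedComponentMk _ ↔ _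
    rw [SimpleGraph.ConnectedComponent.eq]
    refine ⟨fun h => FGGroupClass.isNilpotentGenerator_of_reachable hG h.symm, fun hA => ?_⟩
    have hreach : ∀ (A : Type u) [Group A] [Group.FG A], IsNilpotentGenerator V A →
        ∀ N, Group.rank A < N → preformGraph.Reachable (FGGroupClass.mk A)
          (FGGroupClass.mk (ULift.{u} (RelativelyFreeGroup V N))) := by
      intro A _ _ hA N hN
      rcases FGGroupClass.preformGraph_adj_or_eq (hA.preforms_ulift hroot hN) with h | h
      · exact h.reachable
      · rw [h]
    exact (hreach A hA (Group.rank A + Group.rank G + 1) (by omega)).trans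
      (hreach G hG (Group.rank A + Group.rank G + 1) (by omega)).symm
  have hle : C.toSimpleGraph.ediam ≤ 2 := by
    refine SimpleGraph.ediam_le_of_edist_le ?_
    rintro ⟨a, ha⟩ ⟨b, hb⟩
    obtain ⟨A, _, _, rfl⟩ := FGGroupClass.exists_eq_mk a
    obtain ⟨B, _, _, rfl⟩ := FGGroupClass.exists_eq_mk b
    have hA := (hmem A).mp ha
    have hB := (hmem B).mp hb
    -- A rank above both of the given ones makes the relatively free group a midpoint.
    let N := Group.rank A + Group.rank B + 1
    have hAR := hA.preforms_ulift hroot (N := N) (by omega)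
    have hBR := hB.preforms_ulift hroot (N := N) (by omega)
    have hR := (hmem _).mpr (hA.of_preforms hAR)
    have key : ∀ (A : Type u) [Group A] [Group.FG A] (ha : FGGroupClass.mk A ∈ C.supp),
        Preforms A (ULift.{u} (RelativelyFreeGroup V N)) →
        C.toSimpleGraph.edist ⟨_, ha⟩ ⟨_, hR⟩ ≤ 1 := by
      intro A _ _ ha h
      rw [SimpleGraph.edist_le_one_iff_adj_or_eq]
      rcases FGGroupClass.preformGraph_adj_or_eq h with h | h
      · exact Or.inl h
      · exact Or.inr (Subtype.ext h)
    refine (SimpleGraph.edist_triangle (v := ⟨_, hR⟩)).trans ?_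
    have hBR' := key B hb hBR
    rw [SimpleGraph.edist_comm] at hBR'
    refine (add_le_add (key A ha hAR) hBR').trans ?_
    exact one_add_one_eq_two.le
  refine hle.antisymm ?_
  have h2 := (hmem _).mpr (hXgen.prod_zmod htf 2)
  have h3 := (hmem _).mpr (hXgen.prod_zmod htf 3)
  by_contra! hlt
  have hdist := ENat.lt_two_iff.mp ((SimpleGraph.edist_le_ediam (G := C.toSimpleGraph)
    (u := ⟨_, h2⟩) (v := ⟨_, h3⟩)).trans_lt hlt)
  rw [SimpleGraph.edist_le_one_iff_adj_or_eq] at hdist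
  refine FGGroupClass.not_adj_prod_zmod htf ?_
  rcases hdist with h | h
  · exact Or.inl h
  · exact Or.inr (congrArg Subtype.val h)

theorem theoremA {G : Type u} [Group G] [Group.IsNilpotent G] [Group.FG G]
    (k : ℕ) (hk : Group.rank G ≤ k)
    (hV : groupVariety G = groupVariety (G ⧸ torsionSubgroup G)) :
    (∀ N : ℕ, k < N →
      Preforms G (RelativelyFreeGroup (groupVariety G) N) ∧
      markedRelativelyFreeGroup (groupVariety G) N ∈ closure (markedCopies G N)) ∧
    (Nontrivial G → (preformComponent G).toSimpleGraph.ediam = 2) := by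
  refine ⟨fun N hN => ⟨?_, ?_⟩, fun _ => ediam_preformComponent hV⟩
  · exact preforms_of_ker_eq_verbalSubgroup (hk.trans_lt hN) hV (QuotientGroup.mk' _)
      (QuotientGroup.mk'_surjective _) (QuotientGroup.ker_mk' _)
  · exact markedRelativelyFreeGroup_mem_closure (hk.trans_lt hN) hV
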